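/- Let $n\ge 1$ be an integer and put $R=3\sqrt n$, and write $B_r(0)$ for the open ball of radius $r$ about $0$ in $\mathbb R^n$. There is a constant $C(n)$, depending only on $n$, with the following property. Let $\Theta_0\in\mathbb R$ and let $u=u(x,t)$ be a convex solution of $$u_t=\sum_{i=1}^n\arctan\lambda_i-\Theta_0\qquad(\ast)$$ on $B_{2R+1}(0)\times[0,\tfrac1n]$, where $\lambda_1,\dots,\lambda_n$ are the eigenvalues of the spatial Hessian $D^2u$; that is, $u$ is continuous on $B_{2R+1}(0)\times[0,\tfrac1n]$, smooth on $B_{2R+1}(0)\times(0,\tfrac1n]$ (up to and including the final time), $u(\cdot,t)$ is convex on $B_{2R+1}(0)$ for every $t\in[0,\tfrac1n]$, and $(\ast)$ holds on $B_{2R+1}(0)\times(0,\tfrac1n]$ (with the one-sided time derivative at $t=\tfrac1n$). If $-1\le u(x,0)\le 1$ for all $x\in B_{2R+1}(0)$, then $$D^2u(0,\tfrac1n)\le C(n)\,I_n$$ in the sense of symmetric matrices, i.e. every eigenvalue of $D^2u(0,\tfrac1n)$ is at most $C(n)$. -/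

import Mathlib

open Set Metric
open scoped ContDiff

noncomputable section

/-- The Hessian matrix `D²f(x)` of a function on `ℝⁿ`, with entries `∂ᵢ∂ⱼf(x)`. -/
def hessian {n : ℕ} (f : EuclideanSpace ℝ (Fin n) → ℝ) (x : EuclideanSpace ℝ (Fin n)) :
    Matrix (Fin n) (Fin n) ℝ :=
  Matrix.of fun i j =>
    fderiv ℝ (fderiv ℝ f) x (EuclideanSpace.single i 1) (EuclideanSpace.single j 1)

/-- The Lagrangian angle `∑ arctan λᵢ` of a symmetric matrix, where `λ₁, …, λₙ` are its
eigenvalues, listed with multiplicity (the roots of the characteristic polynomial). -/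
def lagrangianAngle {n : ℕ} (A : Matrix (Fin n) (Fin n) ℝ) : ℝ :=
  (A.charpoly.roots.map Real.arctan).sum

/-- `u(x,t)` is a convex classical solution of `u_t = ∑ arctan λᵢ(D²u) - Θ₀` on
`B_r(0) × [0,T]`: it is continuous there, smooth for positive times (up to and including
the final time `T`, where the time derivative is one-sided), convex in `x` at each time, and
satisfies the equation at each positive time. In particular every convex solution that is smooth
up to the initial time is one. -/
structure IsConvexSolution {n : ℕ} (Θ₀ r T : ℝ) (u : EuclideanSpace ℝ (Fin n) → ℝ → ℝ) :
    Prop where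
  continuousOn : ContinuousOn (fun p : EuclideanSpace ℝ (Fin n) × ℝ => u p.1 p.2)
    (ball 0 r ×ˢ Icc 0 T)
  smooth : ContDiffOn ℝ ∞ (fun p : EuclideanSpace ℝ (Fin n) × ℝ => u p.1 p.2)
    (ball 0 r ×ˢ Ioc 0 T)
  convex : ∀ t ∈ Icc 0 T, ConvexOn ℝ (ball 0 r) (fun x => u x t)
  equation : ∀ x ∈ ball (0 : EuclideanSpace ℝ (Fin n)) r, ∀ t ∈ Ioc 0 T,
    HasDerivWithinAt (fun s => u x s) (lagrangianAngle (hessian (fun y => u y t) x) - Θ₀)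
      (Icc 0 T) t

end

/-!
The estimate is a pointwise maximum principle argument with an explicit constant.

*Gradient bound.* On convex solutions `0 ≤ ∑ arctan λᵢ ≤ nπ/2`, so `u + Θ₀ t` increases in time, by
at most `π/2` up to time `1/n` (`IsConvexSolution.time_bounds`). Hence `u(·,t)` oscillates by at
most `2 + π/2` on the ball, and convexity gives `|Du|² ≤ 13/(25n)` on `|x| ≤ √n`
(`IsConvexSolution.norm_spaceDeriv_sq_le`).

*Cutoff.* Let `g = 1 + (D²u)²` and let `P = ∂_t - g^{ij} ∂ᵢ∂ⱼ` be the linearized operator. Put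
`φ = n² t - |x|² + K |Du|² - 4n/5` with `K = n²/2 + n`. By the gradient bound the part
of `{φ > 0}` in `|x| ≤ √n` lies in `|x| < √n` and away from time `0`, while `φ ≥ n/10` at `x = 0`
near the final time. Each `∂ₖu` solves `P ∂ₖu = 0`, so
`Pφ = n² + ∑ (2 - 2Kλᵢ²)/(1 + λᵢ²)`, which is negative as soon as one eigenvalue has `λ² > K`
(`heat_cutoff`, `cutoff_rate_neg`).

*Jacobi inequality.* If `e` is an eigenvector for the top eigenvalue `λ` at a point, then for the
fixed direction `e` the function `w = u_ee` satisfies `Pw ≤ -2λ/(1 + λ²) |∇w|²_g` at this point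
(`jacobi_inequality`). Fixing `e` avoids the lack of smoothness of the top eigenvalue.

*Conclusion.* Maximize `max(φ, 0)² u_ee` over `|x| ≤ √n` and all unit vectors `e`. At a
maximum `e` may be taken to be a top eigenvector, and the two inequalities for `φ` and `w` contradict each other if
`λ > K + 3` (`false_of_maximum_conditions`). Since `φ < n`, this gives `φ² u_ee ≤ n² (K + 3)`
(`cutoff_sq_mul_spaceHess_le`). The argument is run at times before `1/n`, where `u` is smooth on an
open set, and the bound passes to the limit by smoothness up to the final time.

The function `∑ arctan λᵢ` of a symmetric matrix `A` is never shown to be smooth. It is an argument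
of `det (1 + iA)`, and along the solution it equals `u_t + Θ₀`, which is smooth already. Its first
and second variations follow by differentiating `Im (det (1 + iA) e^{-iθ}) = 0`
(`hasDerivAt_angle`, `hasDerivAt_trace_inv_mul`).
-/

/-! ### Iterated directional derivatives -/

section DirDeriv

open Filter Topology

variable {V : Type*} [NormedAddCommGroup V] [NormedSpace ℝ V] {U : Set V} {f g : V → ℝ} {p : V}

/-- The derivative of `f` at `p` in the direction `v`, as an operator `f ↦ ∂ᵥf` on functions, so
that higher derivatives are iterates `∂ᵥ∂_w f` and the symmetry of second derivatives says that
these operators commute. -/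
noncomputable def dirDeriv (v : V) (f : V → ℝ) (p : V) : ℝ := fderiv ℝ f p v

theorem ContDiffOn.dirDeriv (hf : ContDiffOn ℝ ∞ f U) (hU : IsOpen U) (v : V) :
    ContDiffOn ℝ ∞ (dirDeriv v f) U :=
  (hf.fderiv_of_isOpen hU (by simp)).clm_apply contDiffOn_const

theorem ContDiffOn.differentiableAt_of_isOpen (hf : ContDiffOn ℝ ∞ f U) (hU : IsOpen U)
    (hp : p ∈ U) : DifferentiableAt ℝ f p :=
  (hf.contDiffAt (hU.mem_nhds hp)).differentiableAt (by simp)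

theorem dirDeriv_dirDeriv_eq (hf : ContDiffOn ℝ ∞ f U) (hU : IsOpen U) (hp : p ∈ U) (v w : V) :
    dirDeriv v (dirDeriv w f) p = fderiv ℝ (fderiv ℝ f) p v w := by
  have hd : DifferentiableAt ℝ (fderiv ℝ f) p :=
    ((hf.fderiv_of_isOpen hU (m := ∞) (by simp)).contDiffAt (hU.mem_nhds hp)).differentiableAt
      (by simp)
  unfold dirDeriv
  rw [fderiv_clm_apply hd (differentiableAt_const w)]
  simp

theorem dirDeriv_comm (hf : ContDiffOn ℝ ∞ f U) (hU : IsOpen U) (hp : p ∈ U) (v w : V) :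
    dirDeriv v (dirDeriv w f) p = dirDeriv w (dirDeriv v f) p := by
  rw [dirDeriv_dirDeriv_eq hf hU hp, dirDeriv_dirDeriv_eq hf hU hp]
  refine ((hf.contDiffAt (hU.mem_nhds hp)).isSymmSndFDerivAt ?_).eq v w
  rw [minSmoothness_of_isRCLikeNormedField]
  exact WithTop.coe_le_coe.2 (le_top : (2 : ℕ∞) ≤ ⊤)

theorem dirDeriv_congr (hU : IsOpen U) (h : ∀ q ∈ U, f q = g q) (hp : p ∈ U) (v : V) :
    dirDeriv v f p = dirDeriv v g p := by
  unfold dirDeriv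
  rw [Filter.EventuallyEq.fderiv_eq (f₁ := f) (f := g)]
  exact Filter.eventually_of_mem (hU.mem_nhds hp) h

theorem hasDerivAt_line {v : V} {s : ℝ} (hf : DifferentiableAt ℝ f (p + s • v)) :
    HasDerivAt (fun r : ℝ => f (p + r • v)) (dirDeriv v f (p + s • v)) s := by
  have h1 : HasDerivAt (fun r : ℝ => p + r • v) v s := by
    simpa using ((hasDerivAt_id s).smul_const v).const_add p
  exact hf.hasFDerivAt.comp_hasDerivAt s h1

theorem hasDerivAt_line_zero {v : V} (hf : DifferentiableAt ℝ f p) :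
    HasDerivAt (fun r : ℝ => f (p + r • v)) (dirDeriv v f p) 0 := by
  have := hasDerivAt_line (p := p) (v := v) (s := 0) (f := f) (by simpa using hf)
  simpa using this

theorem eventually_line_mem (hU : IsOpen U) (hp : p ∈ U) (v : V) :
    ∀ᶠ s : ℝ in 𝓝 0, p + s • v ∈ U := by
  have hc : ContinuousAt (fun s : ℝ => p + s • v) 0 := by fun_prop
  exact hc.eventually_mem (by simpa using hU.mem_nhds hp)

theorem dirDeriv_add (hf : DifferentiableAt ℝ f p) (hg : DifferentiableAt ℝ g p) (v : V) :
    dirDeriv v (fun q => f q + g q) p = dirDeriv v f p + dirDeriv v g p := by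
  simp [dirDeriv, fderiv_fun_add hf hg]

theorem dirDeriv_mul (hf : DifferentiableAt ℝ f p) (hg : DifferentiableAt ℝ g p) (v : V) :
    dirDeriv v (fun q => f q * g q) p = dirDeriv v f p * g p + f p * dirDeriv v g p := by
  simp [dirDeriv, fderiv_fun_mul hf hg]; ring

theorem dirDeriv_const_mul (hf : DifferentiableAt ℝ f p) (c : ℝ) (v : V) :
    dirDeriv v (fun q => c * f q) p = c * dirDeriv v f p := by
  simp [dirDeriv, fderiv_const_mul hf]

theorem dirDeriv_sum {ι : Type*} {s : Finset ι} {F : ι → V → ℝ}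
    (hF : ∀ i ∈ s, DifferentiableAt ℝ (F i) p) (v : V) :
    dirDeriv v (fun q => ∑ i ∈ s, F i q) p = ∑ i ∈ s, dirDeriv v (F i) p := by
  simp [dirDeriv, fderiv_fun_sum hF]

theorem dirDeriv_sq (hf : DifferentiableAt ℝ f p) (v : V) :
    dirDeriv v (fun q => f q ^ 2) p = 2 * f p * dirDeriv v f p := by
  simp only [pow_two]
  rw [dirDeriv_mul hf hf]; ring

theorem dirDeriv_dirDeriv_sq (hU : IsOpen U) (hf : ContDiffOn ℝ ∞ f U) (hp : p ∈ U) (v : V) :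
    dirDeriv v (dirDeriv v fun q => f q ^ 2) p
      = 2 * dirDeriv v f p ^ 2 + 2 * f p * dirDeriv v (dirDeriv v f) p := by
  rw [dirDeriv_congr hU (g := fun q => (2 * f q) * dirDeriv v f q)
    (fun q hq => dirDeriv_sq (hf.differentiableAt_of_isOpen hU hq) v) hp]
  have h1 := hf.differentiableAt_of_isOpen hU hp
  rw [dirDeriv_mul (h1.const_mul 2) ((hf.dirDeriv hU v).differentiableAt_of_isOpen hU hp),
    dirDeriv_const_mul h1]
  ring

theorem dirDeriv_sq_mul (hf : DifferentiableAt ℝ f p) (hg : DifferentiableAt ℝ g p) (v : V) :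
    dirDeriv v (fun q => f q ^ 2 * g q) p
      = 2 * f p * dirDeriv v f p * g p + f p ^ 2 * dirDeriv v g p := by
  rw [dirDeriv_mul (f := fun q => f q ^ 2) (hf.pow 2) hg, dirDeriv_sq hf]

theorem dirDeriv_dirDeriv_sq_mul (hU : IsOpen U) (hf : ContDiffOn ℝ ∞ f U)
    (hg : ContDiffOn ℝ ∞ g U) (hp : p ∈ U) (v : V) :
    dirDeriv v (dirDeriv v fun q => f q ^ 2 * g q) p
      = 2 * dirDeriv v f p ^ 2 * g p + 2 * f p * dirDeriv v (dirDeriv v f) p * g p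
        + 4 * f p * dirDeriv v f p * dirDeriv v g p + f p ^ 2 * dirDeriv v (dirDeriv v g) p := by
  rw [dirDeriv_congr hU
    (g := fun q => dirDeriv v (fun r => f r ^ 2) q * g q + f q ^ 2 * dirDeriv v g q)
    (fun q hq => dirDeriv_mul ((hf.differentiableAt_of_isOpen hU hq).pow 2)
      (hg.differentiableAt_of_isOpen hU hq) v) hp]
  have hf2 : ContDiffOn ℝ ∞ (fun r => f r ^ 2) U := hf.pow 2
  have h1 := hf.differentiableAt_of_isOpen hU hp
  have h2 := hf2.differentiableAt_of_isOpen hU hp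
  have h3 := hg.differentiableAt_of_isOpen hU hp
  have h4 := (hf2.dirDeriv hU v).differentiableAt_of_isOpen hU hp
  have h5 := (hg.dirDeriv hU v).differentiableAt_of_isOpen hU hp
  rw [dirDeriv_add (f := fun q => dirDeriv v (fun r => f r ^ 2) q * g q)
    (g := fun q => f q ^ 2 * dirDeriv v g q) (h4.mul h3) (h2.mul h5), dirDeriv_mul h4 h3,
    dirDeriv_mul h2 h5,
    dirDeriv_dirDeriv_sq hU hf hp, dirDeriv_sq h1]
  ring

theorem dirDeriv_dirDeriv_add (hU : IsOpen U) (hf : ContDiffOn ℝ ∞ f U)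
    (hg : ContDiffOn ℝ ∞ g U) (hp : p ∈ U) (v : V) :
    dirDeriv v (dirDeriv v fun q => f q + g q) p
      = dirDeriv v (dirDeriv v f) p + dirDeriv v (dirDeriv v g) p := by
  rw [dirDeriv_congr hU (g := fun q => dirDeriv v f q + dirDeriv v g q)
    (fun q hq => dirDeriv_add (hf.differentiableAt_of_isOpen hU hq)
      (hg.differentiableAt_of_isOpen hU hq) v) hp,
    dirDeriv_add ((hf.dirDeriv hU v).differentiableAt_of_isOpen hU hp)
      ((hg.dirDeriv hU v).differentiableAt_of_isOpen hU hp)]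

theorem dirDeriv_dirDeriv_const_mul (hU : IsOpen U) (hf : ContDiffOn ℝ ∞ f U) (hp : p ∈ U)
    (c : ℝ) (v : V) :
    dirDeriv v (dirDeriv v fun q => c * f q) p = c * dirDeriv v (dirDeriv v f) p := by
  rw [dirDeriv_congr hU (g := fun q => c * dirDeriv v f q)
    (fun q hq => dirDeriv_const_mul (hf.differentiableAt_of_isOpen hU hq) c v) hp,
    dirDeriv_const_mul ((hf.dirDeriv hU v).differentiableAt_of_isOpen hU hp)]

theorem dirDeriv_dirDeriv_sum {ι : Type*} {s : Finset ι} {F : ι → V → ℝ} (hU : IsOpen U)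
    (hF : ∀ i, ContDiffOn ℝ ∞ (F i) U) (hp : p ∈ U) (v : V) :
    dirDeriv v (dirDeriv v fun q => ∑ i ∈ s, F i q) p
      = ∑ i ∈ s, dirDeriv v (dirDeriv v (F i)) p := by
  rw [dirDeriv_congr hU (g := fun q => ∑ i ∈ s, dirDeriv v (F i) q)
    (fun q hq => dirDeriv_sum (fun i _ => (hF i).differentiableAt_of_isOpen hU hq) v) hp,
    dirDeriv_sum fun i _ => ((hF i).dirDeriv hU v).differentiableAt_of_isOpen hU hp]

theorem dirDeriv_clm (l : V →L[ℝ] ℝ) (v p : V) : dirDeriv v (fun q => l q) p = l v := by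
  simp [dirDeriv]

theorem dirDeriv_dirDeriv_clm (l : V →L[ℝ] ℝ) (v w p : V) :
    dirDeriv w (dirDeriv v fun q => l q) p = 0 := by
  have : dirDeriv v (fun q => l q) = fun _ => l v := funext fun q => dirDeriv_clm l v q
  rw [this]
  simp [dirDeriv]

/-- The necessary second-order condition at a local maximum along a line. -/
theorem dirDeriv_of_isLocalMax_line (hU : IsOpen U) (hf : ContDiffOn ℝ ∞ f U) (hp : p ∈ U) {v : V}
    (hmax : IsLocalMax (fun s : ℝ => f (p + s • v)) 0) :
    dirDeriv v f p = 0 ∧ dirDeriv v (dirDeriv v f) p ≤ 0 := by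
  have h1 := hasDerivAt_line_zero (v := v) (hf.differentiableAt_of_isOpen hU hp)
  have h0 : dirDeriv v f p = 0 := hmax.hasDerivAt_eq_zero h1
  refine ⟨h0, ?_⟩
  by_contra! hpos
  set c := dirDeriv v (dirDeriv v f) p with hc
  -- Subtracting half of the second-order term leaves a strict local minimum at `0`.
  set F : ℝ → ℝ := fun s => f (p + s • v) - c / 4 * s ^ 2 with hF
  have hF' : ∀ᶠ s in 𝓝 (0 : ℝ), deriv F s = dirDeriv v f (p + s • v) - c / 2 * s := by
    filter_upwards [eventually_line_mem hU hp v] with s hs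
    have e1 := hasDerivAt_line (v := v) (hf.differentiableAt_of_isOpen hU hs)
    have e2 : HasDerivAt (fun s : ℝ => c / 4 * s ^ 2) (c / 2 * s) s := by
      refine ((hasDerivAt_pow 2 s).const_mul (c / 4)).congr_deriv ?_
      norm_num; ring
    exact (e1.sub e2).deriv
  have hF0 : deriv F 0 = 0 := by
    rw [hF'.self_of_nhds]; simp [h0]
  have hF2 : deriv (deriv F) 0 = c / 2 := by
    rw [Filter.EventuallyEq.deriv_eq hF']
    have e1 := hasDerivAt_line_zero (v := v)
      ((hf.dirDeriv hU v).differentiableAt_of_isOpen hU hp)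
    have e2 : HasDerivAt (fun s : ℝ => c / 2 * s) (c / 2) 0 := by
      simpa using (hasDerivAt_id (0 : ℝ)).const_mul (c / 2)
    rw [(e1.fun_sub e2).deriv, ← hc]; ring
  have hcont : ContinuousAt F 0 := by
    have := h1.continuousAt
    exact this.sub (by fun_prop)
  have hmin : IsLocalMin F 0 :=
    isLocalMin_of_deriv_deriv_pos (by rw [hF2]; linarith) hF0 hcont
  have hev := (hmin.and hmax)
  obtain ⟨s, hs, hs0⟩ := (hev.filter_mono nhdsWithin_le_nhds |>.and
    (self_mem_nhdsWithin (a := (0 : ℝ)) (s := {0}ᶜ))).exists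
  have hs0' : s ≠ 0 := hs0
  have a1 := hs.1
  have a2 := hs.2
  simp only [hF, zero_smul, add_zero] at a1 a2
  have : 0 < s ^ 2 := by positivity
  nlinarith

end DirDeriv

/-! ### Differentiating determinants and inverses of matrices -/

theorem map_ofReal_mul {ι : Type*} [Fintype ι] (X Y : Matrix ι ι ℝ) :
    (X * Y).map (fun x : ℝ => (x : ℂ))
      = X.map (fun x : ℝ => (x : ℂ)) * Y.map (fun x : ℝ => (x : ℂ)) :=
  Matrix.map_mul (f := Complex.ofRealHom)

theorem map_ofReal_one {ι : Type*} [DecidableEq ι] :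
    (1 : Matrix ι ι ℝ).map (fun x : ℝ => (x : ℂ)) = 1 :=
  Matrix.map_one _ Complex.ofReal_zero Complex.ofReal_one

section MatrixCalculus

open Filter Topology

variable {ι : Type*} [Fintype ι] [DecidableEq ι]

/-- Jacobi's formula for the derivative of a determinant. -/
theorem hasDerivAt_det {𝕜 : Type*} [RCLike 𝕜] {M : ℝ → Matrix ι ι 𝕜} {M' : Matrix ι ι 𝕜} {s₀ : ℝ}
    (hM : ∀ i j, HasDerivAt (fun s => M s i j) (M' i j) s₀) :
    HasDerivAt (fun s => (M s).det) ((M s₀).adjugate * M').trace s₀ := by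
  have h1 : HasDerivAt (fun s => (M s).det)
      (∑ σ : Equiv.Perm ι, (Equiv.Perm.sign σ : ℤ) •
        ∑ i, (∏ j ∈ Finset.univ.erase i, M s₀ (σ j) j) • M' (σ i) i) s₀ := by
    simp only [Matrix.det_apply]
    refine HasDerivAt.fun_sum fun σ _ => ?_
    have := HasDerivAt.fun_finsetProd (u := Finset.univ) (fun i _ => hM (σ i) i)
    exact this.const_smul ((Equiv.Perm.sign σ : ℤ))
  convert h1 using 1
  have h2 : ((M s₀).adjugate * M').trace = ∑ i, ((M s₀).updateCol i (fun k => M' k i)).det := by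
    simp only [Matrix.trace, Matrix.diag_apply]
    refine Finset.sum_congr rfl fun i _ => ?_
    rw [← Matrix.cramer_apply, Matrix.cramer_eq_adjugate_mulVec]
    rfl
  rw [h2]
  simp only [Matrix.det_apply, Finset.smul_sum]
  rw [Finset.sum_comm]
  refine Finset.sum_congr rfl fun σ _ => Finset.sum_congr rfl fun i _ => ?_
  rw [← Finset.mul_prod_erase Finset.univ _ (Finset.mem_univ i)]
  have : ∏ j ∈ Finset.univ.erase i, (M s₀).updateCol i (fun k => M' k i) (σ j) j
      = ∏ j ∈ Finset.univ.erase i, M s₀ (σ j) j :=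
    Finset.prod_congr rfl fun j hj => by
      rw [Matrix.updateCol_ne (Finset.ne_of_mem_erase hj)]
  rw [this, Matrix.updateCol_self, smul_eq_mul, mul_comm]
  rfl

theorem differentiableAt_det {M : ℝ → Matrix ι ι ℝ} {s₀ : ℝ}
    (hM : ∀ i j, DifferentiableAt ℝ (fun s => M s i j) s₀) :
    DifferentiableAt ℝ (fun s => (M s).det) s₀ :=
  (hasDerivAt_det (M' := Matrix.of fun i j => deriv (fun s => M s i j) s₀)
    fun i j => (hM i j).hasDerivAt).differentiableAt

/-- The derivative of the inverse matrix, at a parameter where the matrix is diagonal. -/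
theorem hasDerivAt_inv_of_diagonal {B : ℝ → Matrix ι ι ℝ} {B' : Matrix ι ι ℝ} {s₀ : ℝ} {d : ι → ℝ}
    (hB : ∀ i j, HasDerivAt (fun s => B s i j) (B' i j) s₀) (hd : B s₀ = Matrix.diagonal d)
    (hd0 : ∀ i, d i ≠ 0) (i j : ι) :
    HasDerivAt (fun s => (B s)⁻¹ i j) (-(B' i j) / (d i * d j)) s₀ := by
  have hdet0 : (B s₀).det ≠ 0 := by
    rw [hd, Matrix.det_diagonal]; exact Finset.prod_ne_zero_iff.2 fun i _ => hd0 i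
  have hdiff : ∀ i j, DifferentiableAt ℝ (fun s => (B s)⁻¹ i j) s₀ := by
    intro i j
    have e : (fun s => (B s)⁻¹ i j)
        = fun s => ((B s).det)⁻¹ * ((B s).updateRow j (Pi.single i 1)).det := by
      funext s
      rw [Matrix.inv_def, Matrix.smul_apply, Matrix.adjugate_apply, Ring.inverse_eq_inv',
        smul_eq_mul]
    rw [e]
    refine ((differentiableAt_det fun i j => (hB i j).differentiableAt).inv hdet0).mul
      (differentiableAt_det fun k l => ?_)
    by_cases hk : k = j
    · subst hk; simp
    · simpa [Matrix.updateRow_ne hk] using (hB k l).differentiableAt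
  have hev : ∀ᶠ s in 𝓝 s₀, (B s).det ≠ 0 :=
    (differentiableAt_det fun i j => (hB i j).differentiableAt).continuousAt.eventually_ne hdet0
  -- Differentiate `B⁻¹ * B = 1`.
  have hone : (fun s => ∑ k, (B s)⁻¹ i k * B s k j) =ᶠ[𝓝 s₀] fun _ => (1 : Matrix ι ι ℝ) i j := by
    filter_upwards [hev] with s hs
    rw [← Matrix.mul_apply, Matrix.nonsing_inv_mul _ (isUnit_iff_ne_zero.2 hs)]
  have h1 : HasDerivAt (fun s => ∑ k, (B s)⁻¹ i k * B s k j)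
      (∑ k, (deriv (fun s => (B s)⁻¹ i k) s₀ * B s₀ k j + (B s₀)⁻¹ i k * B' k j)) s₀ :=
    HasDerivAt.fun_sum fun k _ => (hdiff i k).hasDerivAt.mul (hB k j)
  have h2 := h1.unique ((hasDerivAt_const s₀ ((1 : Matrix ι ι ℝ) i j)).congr_of_eventuallyEq hone)
  have hinv : (B s₀)⁻¹ = Matrix.diagonal fun i => (d i)⁻¹ := by
    rw [hd]
    refine Matrix.inv_eq_left_inv ?_
    rw [Matrix.diagonal_mul_diagonal, ← Matrix.diagonal_one]
    congr 1; funext i; exact inv_mul_cancel₀ (hd0 i)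
  rw [Finset.sum_add_distrib, hinv, hd] at h2
  simp only [Matrix.diagonal_apply, mul_ite, mul_zero, ite_mul, zero_mul, Finset.sum_ite_eq',
    Finset.sum_ite_eq, Finset.mem_univ, if_true] at h2
  have hi := hd0 i
  have hj := hd0 j
  have h3 : deriv (fun s => (B s)⁻¹ i j) s₀ = -(B' i j) / (d i * d j) := by
    field_simp
    field_simp at h2
    linarith
  rw [← h3]
  exact (hdiff i j).hasDerivAt

/-- The complex matrix `1 + iA`, whose determinant has the Lagrangian angle of `A` as argument. -/
def oneAddI (A : Matrix ι ι ℝ) : Matrix ι ι ℂ :=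
  1 + Complex.I • A.map (fun x : ℝ => (x : ℂ))

theorem posDef_one_add_sq {A : Matrix ι ι ℝ} (hA : A.IsSymm) : (1 + A * A).PosDef := by
  have h : (A * A).PosSemidef := by
    have := Matrix.posSemidef_conjTranspose_mul_self A
    rwa [Matrix.conjTranspose_eq_transpose_of_trivial, hA.eq] at this
  exact Matrix.PosDef.one.add_posSemidef h

/-- The inverse of `1 + iA` is `(1 - iA) (1 + A²)⁻¹`. -/
theorem oneAddI_mul {A : Matrix ι ι ℝ} (hA : A.IsSymm) :
    ((1 - Complex.I • A.map (fun x : ℝ => (x : ℂ))) *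
      ((1 + A * A)⁻¹).map (fun x : ℝ => (x : ℂ))) * oneAddI A = 1 := by
  have hu : IsUnit (1 + A * A).det := (posDef_one_add_sq hA).det_pos.ne'.isUnit
  set a := A.map (fun x : ℝ => (x : ℂ)) with ha
  set g := ((1 + A * A)⁻¹).map (fun x : ℝ => (x : ℂ)) with hg
  have hadd : (1 + A * A).map (fun x : ℝ => (x : ℂ)) = 1 + a * a := by
    rw [Matrix.map_add _ (fun x y => Complex.ofReal_add x y), map_ofReal_one, map_ofReal_mul]
  have hg1 : g * (1 + a * a) = 1 := by
    rw [← hadd, hg, ← map_ofReal_mul, Matrix.nonsing_inv_mul _ hu, map_ofReal_one]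
  have hfac : (1 + Complex.I • a) * (1 - Complex.I • a) = 1 + a * a := by
    simp only [mul_sub, add_mul, mul_one, one_mul, Matrix.smul_mul, Matrix.mul_smul, smul_smul,
      Complex.I_mul_I]
    rw [neg_one_smul]; abel
  have hl : (g * (1 + Complex.I • a)) * (1 - Complex.I • a) = 1 := by
    rw [mul_assoc, hfac, hg1]
  -- `1 - iA` and `g (1 + iA)` are inverse to each other on both sides.
  have hr := mul_eq_one_comm.1 hl
  rw [oneAddI, ← ha, mul_assoc]
  exact hr

theorem det_oneAddI_ne_zero {A : Matrix ι ι ℝ} (hA : A.IsSymm) : (oneAddI A).det ≠ 0 := by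
  intro h
  have := congrArg Matrix.det (oneAddI_mul hA)
  rw [Matrix.det_mul, h, mul_zero, Matrix.det_one] at this
  exact zero_ne_one this

/-- If `θ` is a differentiable argument (modulo `π`) of `det (1 + iA)` along a curve of matrices,
then `θ' = tr ((1 + A²)⁻¹ A')`. -/
theorem hasDerivAt_angle {A : ℝ → Matrix ι ι ℝ} {A' : Matrix ι ι ℝ} {θ : ℝ → ℝ} {θ' s₀ : ℝ}
    (hA : ∀ i j, HasDerivAt (fun s => A s i j) (A' i j) s₀) (hs : (A s₀).IsSymm)
    (hθ : HasDerivAt θ θ' s₀)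
    (him : ∀ᶠ s in 𝓝 s₀, ((oneAddI (A s)).det * Complex.exp (-(θ s * Complex.I))).im = 0) :
    θ' = ((1 + A s₀ * A s₀)⁻¹ * A').trace := by
  set W := (oneAddI (A s₀)).det with hW
  set E := Complex.exp (-(θ s₀ * Complex.I)) with hE
  have hW0 : W ≠ 0 := det_oneAddI_ne_zero hs
  set G := (1 + A s₀ * A s₀)⁻¹ with hG
  have htr : ∀ X : Matrix ι ι ℝ, (X.map (fun x : ℝ => (x : ℂ))).trace = (X.trace : ℂ) := by
    intro X; simp [Matrix.trace]
  have h1 : HasDerivAt (fun s => (oneAddI (A s)).det)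
      ((oneAddI (A s₀)).adjugate * (Complex.I • A'.map (fun x : ℝ => (x : ℂ)))).trace s₀ := by
    refine hasDerivAt_det fun i j => ?_
    have := (((hA i j).ofReal_comp).const_mul Complex.I).const_add ((1 : Matrix ι ι ℂ) i j)
    simpa [oneAddI] using this
  have hadj : (oneAddI (A s₀)).adjugate
      = W • ((1 - Complex.I • (A s₀).map (fun x : ℝ => (x : ℂ))) *
        G.map (fun x : ℝ => (x : ℂ))) := by
    have e1 := Matrix.mul_adjugate (oneAddI (A s₀))
    have e2 := congrArg (fun X => ((1 - Complex.I • (A s₀).map (fun x : ℝ => (x : ℂ))) *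
      G.map (fun x : ℝ => (x : ℂ))) * X) e1
    rw [← mul_assoc, oneAddI_mul hs, one_mul] at e2
    rw [e2, hG, hW]
    simp
  have htr1 : ((oneAddI (A s₀)).adjugate * (Complex.I • A'.map (fun x : ℝ => (x : ℂ)))).trace
      = W * (((A s₀ * G * A').trace : ℝ) + ((G * A').trace : ℝ) * Complex.I) := by
    rw [hadj, ← htr, ← htr, map_ofReal_mul, map_ofReal_mul, map_ofReal_mul]
    simp only [Matrix.smul_mul, Matrix.mul_smul, sub_mul, one_mul, Matrix.trace_smul,
      Matrix.trace_sub, smul_sub, smul_smul, smul_eq_mul]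
    linear_combination (-W * ((A s₀).map (fun x : ℝ => (x : ℂ)) * G.map (fun x : ℝ => (x : ℂ)) *
      A'.map (fun x : ℝ => (x : ℂ))).trace) * Complex.I_mul_I
  rw [htr1] at h1
  have h2 : HasDerivAt (fun s => Complex.exp (-(θ s * Complex.I))) (E * -(θ' * Complex.I)) s₀ :=
    (((hθ.ofReal_comp).mul_const Complex.I).neg).cexp
  have h3 := h1.mul h2
  have h4 : HasDerivAt
      (fun s => ((oneAddI (A s)).det * Complex.exp (-(θ s * Complex.I))).im) _ s₀ :=
    Complex.imCLM.hasFDerivAt.comp_hasDerivAt s₀ h3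
  have h5 := h4.unique ((hasDerivAt_const s₀ (0 : ℝ)).congr_of_eventuallyEq him)
  have him0 : (W * E).im = 0 := him.self_of_nhds
  have hE0 : E ≠ 0 := Complex.exp_ne_zero _
  have hre : (W * E).re ≠ 0 := by
    intro h
    exact mul_ne_zero hW0 hE0 (Complex.ext h him0)
  simp only [Complex.imCLM_apply] at h5
  have h6 : W * (((A s₀ * G * A').trace : ℝ) + ((G * A').trace : ℝ) * Complex.I) * E
      + W * (E * -(θ' * Complex.I))
      = (W * E) * (((A s₀ * G * A').trace : ℝ) + (((G * A').trace - θ' : ℝ) : ℂ) * Complex.I) := by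
    push_cast; ring
  rw [← hW, ← hE, h6] at h5
  simp [Complex.mul_im, him0] at h5
  simp only [Complex.mul_re, Complex.mul_im] at hre him0
  rcases h5 with h5 | h5
  · exact absurd h5 (by simpa [Complex.mul_re] using hre)
  · linarith

theorem inv_one_add_sq_of_diagonal {A : Matrix ι ι ℝ} {l : ι → ℝ}
    (hd : A = Matrix.diagonal l) :
    (1 + A * A)⁻¹ = Matrix.diagonal fun i => (1 + l i ^ 2)⁻¹ := by
  refine Matrix.inv_eq_left_inv ?_
  rw [hd, Matrix.diagonal_mul_diagonal, ← Matrix.diagonal_one, Matrix.diagonal_add,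
    Matrix.diagonal_mul_diagonal]
  congr 1
  funext i
  have : 1 + l i ^ 2 ≠ 0 := by positivity
  field_simp

/-- The second derivative of the Lagrangian angle along a curve of matrices, at a parameter where
the matrix is diagonal. -/
theorem hasDerivAt_trace_inv_mul {A A' : ℝ → Matrix ι ι ℝ} {A'' : Matrix ι ι ℝ} {s₀ : ℝ}
    {l : ι → ℝ} (hA : ∀ i j, HasDerivAt (fun s => A s i j) (A' s₀ i j) s₀)
    (hA' : ∀ i j, HasDerivAt (fun s => A' s i j) (A'' i j) s₀)
    (hd : A s₀ = Matrix.diagonal l) :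
    HasDerivAt (fun s => ((1 + A s * A s)⁻¹ * A' s).trace)
      (∑ i, A'' i i / (1 + l i ^ 2)
        - ∑ i, ∑ j, (l i + l j) * (A' s₀ i j * A' s₀ j i) / ((1 + l i ^ 2) * (1 + l j ^ 2)))
      s₀ := by
  have hB : ∀ i j, HasDerivAt (fun s => (1 + A s * A s) i j)
      (Matrix.of (fun i j => (l i + l j) * A' s₀ i j) i j) s₀ := by
    intro i j
    have h1 : HasDerivAt (fun s => ∑ k, A s i k * A s k j)
        (∑ k, (A' s₀ i k * A s₀ k j + A s₀ i k * A' s₀ k j)) s₀ :=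
      HasDerivAt.fun_sum fun k _ => (hA i k).mul (hA k j)
    have h2 := h1.const_add ((1 : Matrix ι ι ℝ) i j)
    simp only [Matrix.add_apply, Matrix.mul_apply, Matrix.of_apply]
    refine h2.congr_deriv ?_
    rw [Finset.sum_add_distrib, hd]
    simp [Matrix.diagonal_apply]
    ring
  have hBd : 1 + A s₀ * A s₀ = Matrix.diagonal fun i => 1 + l i ^ 2 := by
    rw [hd, Matrix.diagonal_mul_diagonal, ← Matrix.diagonal_one, Matrix.diagonal_add]
    congr 1; funext i; ring
  have hne : ∀ i, 1 + l i ^ 2 ≠ 0 := fun i => by positivity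
  have hinv := inv_one_add_sq_of_diagonal hd
  have hG := fun i j => hasDerivAt_inv_of_diagonal hB hBd hne i j
  have h1 : HasDerivAt (fun s => ∑ i, ∑ j, (1 + A s * A s)⁻¹ i j * A' s j i)
      (∑ i, ∑ j, (-((l i + l j) * A' s₀ i j) / ((1 + l i ^ 2) * (1 + l j ^ 2)) * A' s₀ j i
        + (1 + A s₀ * A s₀)⁻¹ i j * A'' j i)) s₀ :=
    HasDerivAt.fun_sum fun i _ => HasDerivAt.fun_sum fun j _ => (hG i j).mul (hA' j i)
  have e : (fun s => ((1 + A s * A s)⁻¹ * A' s).trace)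
      = fun s => ∑ i, ∑ j, (1 + A s * A s)⁻¹ i j * A' s j i := by
    funext s; simp [Matrix.trace, Matrix.mul_apply]
  rw [e]
  refine h1.congr_deriv (Eq.symm ?_)
  simp only [Finset.sum_add_distrib, hinv, Matrix.diagonal_apply, ite_mul, zero_mul,
    Finset.sum_ite_eq, Finset.mem_univ, if_true]
  rw [add_comm, sub_eq_add_neg, ← Finset.sum_neg_distrib]
  congr 1
  · refine Finset.sum_congr rfl fun i _ => ?_
    rw [div_eq_inv_mul]
  · refine Finset.sum_congr rfl fun i _ => ?_
    rw [← Finset.sum_neg_distrib]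
    refine Finset.sum_congr rfl fun j _ => ?_
    ring

end MatrixCalculus

/-! ### The Lagrangian angle as an argument of `det (1 + iA)` -/

section Angle

variable {n : ℕ} {A : Matrix (Fin n) (Fin n) ℝ}

theorem Matrix.IsSymm.isHermitian_real (hA : A.IsSymm) : A.IsHermitian := by
  rw [Matrix.IsHermitian, Matrix.conjTranspose_eq_transpose_of_trivial, hA.eq]

theorem lagrangianAngle_eq_sum (hA : A.IsHermitian) :
    lagrangianAngle A = ∑ i, Real.arctan (hA.eigenvalues i) := by
  rw [lagrangianAngle, hA.roots_charpoly_eq_eigenvalues, Multiset.map_map]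
  rfl

theorem lagrangianAngle_nonneg (hA : A.PosSemidef) : 0 ≤ lagrangianAngle A := by
  rw [lagrangianAngle_eq_sum hA.isHermitian]
  exact Finset.sum_nonneg fun i _ => Real.arctan_nonneg.2 (hA.eigenvalues_nonneg i)

theorem lagrangianAngle_le (hA : A.IsHermitian) : lagrangianAngle A ≤ n * (Real.pi / 2) := by
  rw [lagrangianAngle_eq_sum hA]
  calc ∑ i, Real.arctan (hA.eigenvalues i) ≤ ∑ _i : Fin n, Real.pi / 2 :=
        Finset.sum_le_sum fun i _ => (Real.arctan_lt_pi_div_two _).le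
    _ = n * (Real.pi / 2) := by simp

theorem det_oneAddI_eq_prod (hA : A.IsHermitian) :
    (oneAddI A).det = ∏ i, (1 + Complex.I * (hA.eigenvalues i : ℂ)) := by
  have h1 : (oneAddI A) = (-Complex.I) •
      (Matrix.scalar (Fin n) Complex.I - A.map (fun x : ℝ => (x : ℂ))) := by
    rw [oneAddI, smul_sub, Matrix.scalar_apply, ← Matrix.smul_one_eq_diagonal, smul_smul]
    simp
  have h2 : (A.map (fun x : ℝ => (x : ℂ))).charpoly = A.charpoly.map Complex.ofRealHom :=
    Matrix.charpoly_map A Complex.ofRealHom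
  rw [h1, Matrix.det_smul, ← Matrix.eval_charpoly, h2, hA.charpoly_eq, Polynomial.map_prod,
    Polynomial.eval_prod, ← Finset.card_univ, ← Finset.prod_const, ← Finset.prod_mul_distrib]
  refine Finset.prod_congr rfl fun i _ => ?_
  simp
  linear_combination -Complex.I_mul_I

theorem one_add_I_mul_eq (x : ℝ) :
    1 + Complex.I * (x : ℂ)
      = (Real.sqrt (1 + x ^ 2) : ℝ) * Complex.exp (Real.arctan x * Complex.I) := by
  have h : Real.sqrt (1 + x ^ 2) ≠ 0 := (Real.sqrt_pos.2 (by positivity)).ne'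
  rw [Complex.exp_mul_I, ← Complex.ofReal_cos, ← Complex.ofReal_sin, Real.cos_arctan,
    Real.sin_arctan]
  push_cast
  have h' : ((Real.sqrt (1 + x ^ 2) : ℝ) : ℂ) ≠ 0 := by exact_mod_cast h
  field_simp

/-- The Lagrangian angle is an argument of `det (1 + iA)`; the quotient is `∏ √(1 + λᵢ²)`. -/
theorem det_oneAddI_mul_exp_im (hA : A.IsSymm) :
    ((oneAddI A).det * Complex.exp (-(lagrangianAngle A * Complex.I))).im = 0 := by
  have hH := hA.isHermitian_real
  rw [det_oneAddI_eq_prod hH, lagrangianAngle_eq_sum hH]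
  simp_rw [one_add_I_mul_eq]
  rw [Finset.prod_mul_distrib, ← Complex.exp_sum, mul_assoc, ← Complex.exp_add, ← Finset.sum_mul]
  push_cast
  rw [add_neg_cancel, Complex.exp_zero, mul_one, ← Complex.ofReal_prod]
  exact Complex.ofReal_im _

/-- `det (1 + iA)` is invariant under orthogonal changes of basis. -/
theorem det_oneAddI_conj {B : Matrix (Fin n) (Fin n) ℝ} (hB : B.transpose * B = 1) :
    (oneAddI (B.transpose * A * B)).det = (oneAddI A).det := by
  have hB' := congrArg (fun X => X.map (fun x : ℝ => (x : ℂ))) hB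
  simp only [map_ofReal_mul, map_ofReal_one] at hB'
  have e : oneAddI (B.transpose * A * B)
      = B.transpose.map (fun x : ℝ => (x : ℂ)) * oneAddI A * B.map (fun x : ℝ => (x : ℂ)) := by
    rw [oneAddI, oneAddI, map_ofReal_mul, map_ofReal_mul, mul_add, add_mul, mul_one, hB',
      Matrix.mul_smul, Matrix.smul_mul]
  rw [e, Matrix.det_mul, Matrix.det_mul, mul_right_comm, ← Matrix.det_mul, hB', Matrix.det_one,
    one_mul]

end Angle

/-! ### Differentiating the equation in space -/

section Linearization

open Filter Topology

variable {V : Type*} [NormedAddCommGroup V] [NormedSpace ℝ V] {U : Set V} {f θ : V → ℝ} {p : V}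
  {n : ℕ}

/-- The matrix of second derivatives of `f` in the directions `e₁, …, eₙ`. -/
noncomputable def hessMatrix (e : Fin n → V) (f : V → ℝ) (p : V) : Matrix (Fin n) (Fin n) ℝ :=
  Matrix.of fun i j => dirDeriv (e i) (dirDeriv (e j) f) p

theorem hessMatrix_isSymm (hU : IsOpen U) (hf : ContDiffOn ℝ ∞ f U) (hp : p ∈ U) (e : Fin n → V) :
    (hessMatrix e f p).IsSymm :=
  Matrix.IsSymm.ext fun i j => dirDeriv_comm hf hU hp (e j) (e i)

theorem hasDerivAt_hessMatrix (hU : IsOpen U) (hf : ContDiffOn ℝ ∞ f U) (e : Fin n → V) (v : V)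
    {s : ℝ} (hs : p + s • v ∈ U) (i j : Fin n) :
    HasDerivAt (fun r : ℝ => hessMatrix e f (p + r • v) i j)
      (dirDeriv v (dirDeriv (e i) (dirDeriv (e j) f)) (p + s • v)) s :=
  hasDerivAt_line (((hf.dirDeriv hU _).dirDeriv hU _).differentiableAt_of_isOpen hU hs)

theorem dirDeriv_angle (hU : IsOpen U) (hf : ContDiffOn ℝ ∞ f U) (hθ : ContDiffOn ℝ ∞ θ U)
    {e : Fin n → V}
    (him : ∀ q ∈ U,
      ((oneAddI (hessMatrix e f q)).det * Complex.exp (-(θ q * Complex.I))).im = 0)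
    (hp : p ∈ U) (v : V) :
    dirDeriv v θ p = ((1 + hessMatrix e f p * hessMatrix e f p)⁻¹ *
      Matrix.of fun i j => dirDeriv v (dirDeriv (e i) (dirDeriv (e j) f)) p).trace := by
  have h0 : p + (0 : ℝ) • v ∈ U := by simpa using hp
  have := hasDerivAt_angle (A := fun s => hessMatrix e f (p + s • v))
    (A' := Matrix.of fun i j =>
      dirDeriv v (dirDeriv (e i) (dirDeriv (e j) f)) (p + (0 : ℝ) • v))
    (fun i j => hasDerivAt_hessMatrix hU hf e v h0 i j) (hessMatrix_isSymm hU hf h0 e)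
    (hasDerivAt_line (hθ.differentiableAt_of_isOpen hU h0))
    ((eventually_line_mem hU hp v).mono fun s hs => him _ hs)
  simpa using this

/-- The first variation of the angle in directions diagonalizing the Hessian at the point. -/
theorem dirDeriv_angle_of_diagonal
    (hU : IsOpen U) (hf : ContDiffOn ℝ ∞ f U) (hθ : ContDiffOn ℝ ∞ θ U) {e : Fin n → V}
    (him : ∀ q ∈ U,
      ((oneAddI (hessMatrix e f q)).det * Complex.exp (-(θ q * Complex.I))).im = 0)
    (hp : p ∈ U) (v : V) {l : Fin n → ℝ}
    (hd : hessMatrix e f p = Matrix.diagonal l) :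
    dirDeriv v θ p
      = ∑ i, dirDeriv v (dirDeriv (e i) (dirDeriv (e i) f)) p / (1 + l i ^ 2) := by
  rw [dirDeriv_angle hU hf hθ him hp v, inv_one_add_sq_of_diagonal hd]
  simp [Matrix.trace, Matrix.diagonal_mul, div_eq_inv_mul]

/-- The second variation of the angle in directions diagonalizing the Hessian at the point. -/
theorem dirDeriv_dirDeriv_angle_of_diagonal
    (hU : IsOpen U) (hf : ContDiffOn ℝ ∞ f U) (hθ : ContDiffOn ℝ ∞ θ U) {e : Fin n → V}
    (him : ∀ q ∈ U,
      ((oneAddI (hessMatrix e f q)).det * Complex.exp (-(θ q * Complex.I))).im = 0)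
    (hp : p ∈ U) (v : V) {l : Fin n → ℝ}
    (hd : hessMatrix e f p = Matrix.diagonal l) :
    dirDeriv v (dirDeriv v θ) p
      = ∑ i, dirDeriv v (dirDeriv v (dirDeriv (e i) (dirDeriv (e i) f))) p / (1 + l i ^ 2)
        - ∑ i, ∑ j, (l i + l j) * dirDeriv v (dirDeriv (e i) (dirDeriv (e j) f)) p ^ 2
            / ((1 + l i ^ 2) * (1 + l j ^ 2)) := by
  have h0 : p + (0 : ℝ) • v ∈ U := by simpa using hp
  have h1 := hasDerivAt_line_zero (v := v) ((hθ.dirDeriv hU v).differentiableAt_of_isOpen hU hp)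
  have h2 := hasDerivAt_trace_inv_mul (s₀ := 0) (l := l)
    (A := fun s => hessMatrix e f (p + s • v))
    (A' := fun s => Matrix.of fun i j =>
      dirDeriv v (dirDeriv (e i) (dirDeriv (e j) f)) (p + s • v))
    (A'' := Matrix.of fun i j =>
      dirDeriv v (dirDeriv v (dirDeriv (e i) (dirDeriv (e j) f))) (p + (0 : ℝ) • v))
    (fun i j => hasDerivAt_hessMatrix hU hf e v h0 i j)
    (fun i j => hasDerivAt_line ((((hf.dirDeriv hU _).dirDeriv hU _).dirDeriv hU
      v).differentiableAt_of_isOpen hU h0)) (by simpa using hd)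
  have h3 := h1.unique (h2.congr_of_eventuallyEq
    ((eventually_line_mem hU hp v).mono fun s hs => dirDeriv_angle hU hf hθ him hs v))
  rw [h3]
  simp only [zero_smul, add_zero, Matrix.of_apply]
  congr 1
  refine Finset.sum_congr rfl fun i _ => Finset.sum_congr rfl fun j _ => ?_
  have hc : dirDeriv v (dirDeriv (e j) (dirDeriv (e i) f)) p
      = dirDeriv v (dirDeriv (e i) (dirDeriv (e j) f)) p :=
    dirDeriv_congr hU (fun q hq => dirDeriv_comm hf hU hq _ _) hp v
  rw [hc, ← pow_two]

end Linearization

/-! ### Evolution inequalities at a point where the Hessian is diagonal -/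

section Evolution

variable {V : Type*} [NormedAddCommGroup V] [NormedSpace ℝ V] {U : Set V} {f θ : V → ℝ} {p : V}
  {n : ℕ}

/-- Keeping only the terms of the quadratic form that involve the index `m`. -/
theorem two_mul_sum_row_le_sum {l : Fin n → ℝ} (hl : ∀ i, 0 ≤ l i) {T : Fin n → Fin n → ℝ}
    (hT : ∀ i j, T i j = T j i) (m : Fin n) :
    2 * l m / (1 + l m ^ 2) * ∑ j, T j m ^ 2 / (1 + l j ^ 2)
      ≤ ∑ i, ∑ j, (l i + l j) * T i j ^ 2 / ((1 + l i ^ 2) * (1 + l j ^ 2)) := by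
  set S : Fin n → Fin n → ℝ := fun i j => l i * T i j ^ 2 / ((1 + l i ^ 2) * (1 + l j ^ 2)) with hS
  have h1 : ∑ i, ∑ j, (l i + l j) * T i j ^ 2 / ((1 + l i ^ 2) * (1 + l j ^ 2))
      = 2 * ∑ i, ∑ j, S i j := by
    have e : ∀ i j, (l i + l j) * T i j ^ 2 / ((1 + l i ^ 2) * (1 + l j ^ 2)) = S i j + S j i := by
      intro i j
      simp only [hS, hT j i]
      rw [mul_comm (1 + l j ^ 2), ← add_div, add_mul]
    simp_rw [e, Finset.sum_add_distrib]
    rw [Finset.sum_comm (f := fun i j => S j i), two_mul]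
  rw [h1]
  have h2 : ∑ j, S m j ≤ ∑ i, ∑ j, S i j :=
    Finset.single_le_sum (f := fun i => ∑ j, S i j)
      (fun i _ => Finset.sum_nonneg fun j _ => by
        have := hl i
        positivity) (Finset.mem_univ m)
  have h3 : 2 * l m / (1 + l m ^ 2) * ∑ j, T j m ^ 2 / (1 + l j ^ 2) = 2 * ∑ j, S m j := by
    rw [Finset.mul_sum, Finset.mul_sum]
    refine Finset.sum_congr rfl fun j _ => ?_
    simp only [hS, hT j m]
    field_simp
  rw [h3]
  linarith

/-- The Jacobi inequality: with `w = ∂ₘ∂ₘf` and `g = 1 + (D²f)²`, the equation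
`∂_τ f = θ` (up to a constant) gives `∂_τ w - tr (g⁻¹ D²w) ≤ -2λₘ / (1 + λₘ²) |∇w|²_g` at a point
where the Hessian is diagonal with entries `λᵢ ≥ 0`. -/
theorem jacobi_inequality (hU : IsOpen U) (hf : ContDiffOn ℝ ∞ f U) {τ : V} {c : ℝ} {e : Fin n → V}
    (him : ∀ q ∈ U, ((oneAddI (hessMatrix e f q)).det *
      Complex.exp (-((dirDeriv τ f q + c : ℝ) * Complex.I))).im = 0)
    (hp : p ∈ U) {l : Fin n → ℝ} (hd : hessMatrix e f p = Matrix.diagonal l) (hl : ∀ i, 0 ≤ l i)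
    (m : Fin n) :
    dirDeriv τ (dirDeriv (e m) (dirDeriv (e m) f)) p
      - ∑ i, dirDeriv (e i) (dirDeriv (e i) (dirDeriv (e m) (dirDeriv (e m) f))) p / (1 + l i ^ 2)
      ≤ -(2 * l m / (1 + l m ^ 2) *
        ∑ j, dirDeriv (e j) (dirDeriv (e m) (dirDeriv (e m) f)) p ^ 2 / (1 + l j ^ 2)) := by
  have hθ : ContDiffOn ℝ ∞ (fun q => dirDeriv τ f q + c) U :=
    (hf.dirDeriv hU τ).add contDiffOn_const
  have hfm := hf.dirDeriv hU (e m)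
  -- Derivatives commute, so `∂_τ w = ∂ₘ∂ₘ θ`.
  have h1 : dirDeriv τ (dirDeriv (e m) (dirDeriv (e m) f)) p
      = dirDeriv (e m) (dirDeriv (e m) fun q => dirDeriv τ f q + c) p := by
    rw [dirDeriv_comm hfm hU hp]
    refine dirDeriv_congr hU (fun q hq => ?_) hp _
    rw [dirDeriv_comm hf hU hq, dirDeriv_add
      ((hf.dirDeriv hU τ).differentiableAt_of_isOpen hU hq) (differentiableAt_const c)]
    simp [dirDeriv]
  rw [h1, dirDeriv_dirDeriv_angle_of_diagonal hU hf hθ him hp (e m) hd]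
  have h2 : ∀ i, dirDeriv (e m) (dirDeriv (e m) (dirDeriv (e i) (dirDeriv (e i) f))) p
      = dirDeriv (e i) (dirDeriv (e i) (dirDeriv (e m) (dirDeriv (e m) f))) p := by
    intro i
    have hfi := hf.dirDeriv hU (e i)
    calc _ = dirDeriv (e m) (dirDeriv (e i) (dirDeriv (e m) (dirDeriv (e i) f))) p :=
          dirDeriv_congr hU (fun q hq => dirDeriv_comm hfi hU hq _ _) hp _
      _ = dirDeriv (e m) (dirDeriv (e i) (dirDeriv (e i) (dirDeriv (e m) f))) p :=
          dirDeriv_congr hU (fun q hq => dirDeriv_congr hU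
            (fun r hr => dirDeriv_comm hf hU hr _ _) hq _) hp _
      _ = dirDeriv (e i) (dirDeriv (e m) (dirDeriv (e i) (dirDeriv (e m) f))) p :=
          dirDeriv_comm (hfm.dirDeriv hU _) hU hp _ _
      _ = _ := dirDeriv_congr hU (fun q hq => dirDeriv_comm hfm hU hq _ _) hp _
  simp_rw [h2]
  have hT : ∀ i j, dirDeriv (e m) (dirDeriv (e i) (dirDeriv (e j) f)) p
      = dirDeriv (e m) (dirDeriv (e j) (dirDeriv (e i) f)) p := fun i j =>
    dirDeriv_congr hU (fun q hq => dirDeriv_comm hf hU hq _ _) hp _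
  have h3 := two_mul_sum_row_le_sum hl hT m
  have h4 : ∀ j, dirDeriv (e m) (dirDeriv (e j) (dirDeriv (e m) f)) p
      = dirDeriv (e j) (dirDeriv (e m) (dirDeriv (e m) f)) p := fun j =>
    dirDeriv_comm hfm hU hp _ _
  simp_rw [h4] at h3
  linarith

/-- The heat operator of the induced metric applied to `K |Df|²`: the third derivatives of `f`
cancel, since each `∂ₖf` solves the linearized equation. -/
theorem heat_gradient_sq (hU : IsOpen U) (hf : ContDiffOn ℝ ∞ f U) {τ : V} {c : ℝ} {e : Fin n → V}
    (him : ∀ q ∈ U, ((oneAddI (hessMatrix e f q)).det *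
      Complex.exp (-((dirDeriv τ f q + c : ℝ) * Complex.I))).im = 0)
    (hp : p ∈ U) {l : Fin n → ℝ} (hd : hessMatrix e f p = Matrix.diagonal l) :
    dirDeriv τ (fun q => ∑ k, dirDeriv (e k) f q ^ 2) p
      - ∑ i, dirDeriv (e i) (dirDeriv (e i) fun q => ∑ k, dirDeriv (e k) f q ^ 2) p / (1 + l i ^ 2)
      = -∑ i, 2 * l i ^ 2 / (1 + l i ^ 2) := by
  have hθ : ContDiffOn ℝ ∞ (fun q => dirDeriv τ f q + c) U :=
    (hf.dirDeriv hU τ).add contDiffOn_const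
  have hfk := fun k => hf.dirDeriv hU (e k)
  have h1 : dirDeriv τ (fun q => ∑ k, dirDeriv (e k) f q ^ 2) p
      = ∑ k, 2 * dirDeriv (e k) f p *
        ∑ i, dirDeriv (e i) (dirDeriv (e i) (dirDeriv (e k) f)) p / (1 + l i ^ 2) := by
    rw [dirDeriv_sum (F := fun k q => dirDeriv (e k) f q ^ 2)
      fun k _ => ((hfk k).differentiableAt_of_isOpen hU hp).pow 2]
    refine Finset.sum_congr rfl fun k _ => ?_
    rw [dirDeriv_sq ((hfk k).differentiableAt_of_isOpen hU hp), dirDeriv_comm hf hU hp]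
    have : dirDeriv (e k) (dirDeriv τ f) p = dirDeriv (e k) (fun q => dirDeriv τ f q + c) p := by
      rw [dirDeriv_add ((hf.dirDeriv hU τ).differentiableAt_of_isOpen hU hp)
        (differentiableAt_const c)]
      simp [dirDeriv]
    rw [this, dirDeriv_angle_of_diagonal hU hf hθ him hp (e k) hd]
    congr 1
    refine Finset.sum_congr rfl fun i _ => ?_
    congr 1
    rw [dirDeriv_comm (hfk i) hU hp]
    exact dirDeriv_congr hU (fun q hq => dirDeriv_comm hf hU hq _ _) hp _
  have h2 : ∀ i, dirDeriv (e i) (dirDeriv (e i) fun q => ∑ k, dirDeriv (e k) f q ^ 2) p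
      = 2 * l i ^ 2 + ∑ k, 2 * dirDeriv (e k) f p *
        dirDeriv (e i) (dirDeriv (e i) (dirDeriv (e k) f)) p := by
    intro i
    rw [dirDeriv_dirDeriv_sum hU (fun k => (hfk k).pow 2) hp]
    simp_rw [fun k => dirDeriv_dirDeriv_sq hU (hfk k) hp (e i)]
    rw [Finset.sum_add_distrib]
    congr 1
    have : ∀ k, dirDeriv (e i) (dirDeriv (e k) f) p = Matrix.diagonal l i k := fun k => by
      rw [← hd]; rfl
    simp_rw [this]
    rw [Finset.sum_eq_single i (fun k _ hk => by simp [Matrix.diagonal_apply_ne' l hk]) (by simp)]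
    simp
  rw [h1]
  simp_rw [h2, add_div, Finset.sum_add_distrib, Finset.mul_sum, Finset.sum_div]
  rw [Finset.sum_comm]
  simp_rw [mul_div_assoc]
  ring

/-- The conditions at an interior maximum of `φ² w` contradict the Jacobi inequality for `w` and
`(∂_τ - tr (g⁻¹ D²)) φ < 0` once `w² ≥ 3`: the gradient terms have the sign of
`6 - 8 w² / (1 + w²)`. Subscripts denote derivatives and `G` the diagonal of `g⁻¹`. -/
theorem false_of_maximum_conditions {φ w φt wt : ℝ} {G φi wi φii wii : Fin n → ℝ}
    (hφ : 0 < φ) (hw : 0 < w) (hw3 : 3 ≤ w ^ 2) (hG : ∀ i, 0 ≤ G i)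
    (ht : 0 ≤ 2 * φ * φt * w + φ ^ 2 * wt)
    (hi : ∀ i, 2 * φ * φi i * w + φ ^ 2 * wi i = 0)
    (hii : ∀ i, 2 * φi i ^ 2 * w + 2 * φ * φii i * w + 4 * φ * φi i * wi i + φ ^ 2 * wii i ≤ 0)
    (hjac : wt - ∑ i, G i * wii i ≤ -(2 * w / (1 + w ^ 2) * ∑ i, G i * wi i ^ 2))
    (hcut : φt - ∑ i, G i * φii i < 0) : False := by
  have hwi : ∀ i, φ * wi i = -2 * w * φi i := by
    intro i
    have h : φ * (φ * wi i + 2 * w * φi i) = 0 := by linarith [hi i]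
    have := (mul_eq_zero.1 h).resolve_left hφ.ne'
    linarith
  set S := ∑ i, G i * φi i ^ 2 with hS
  have hS0 : 0 ≤ S := Finset.sum_nonneg fun i _ => mul_nonneg (hG i) (sq_nonneg _)
  have h1 : φ ^ 2 * ∑ i, G i * wi i ^ 2 = 4 * w ^ 2 * S := by
    rw [hS, Finset.mul_sum, Finset.mul_sum]
    refine Finset.sum_congr rfl fun i _ => ?_
    have : (φ * wi i) ^ 2 = (-2 * w * φi i) ^ 2 := by rw [hwi i]
    linear_combination G i * this
  have h2 : ∑ i, G i * (2 * φi i ^ 2 * w + 2 * φ * φii i * w + 4 * φ * φi i * wi i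
      + φ ^ 2 * wii i) ≤ 0 :=
    Finset.sum_nonpos fun i _ => mul_nonpos_of_nonneg_of_nonpos (hG i) (hii i)
  have h3 : ∑ i, G i * (2 * φi i ^ 2 * w + 2 * φ * φii i * w + 4 * φ * φi i * wi i
      + φ ^ 2 * wii i)
      = -6 * w * S + 2 * φ * w * ∑ i, G i * φii i + φ ^ 2 * ∑ i, G i * wii i := by
    rw [hS, Finset.mul_sum, Finset.mul_sum, Finset.mul_sum, ← Finset.sum_add_distrib,
      ← Finset.sum_add_distrib]
    refine Finset.sum_congr rfl fun i _ => ?_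
    linear_combination 4 * G i * φi i * hwi i
  have h4 : φ ^ 2 * (wt - ∑ i, G i * wii i) ≤ -(2 * w / (1 + w ^ 2) * (4 * w ^ 2 * S)) := by
    rw [← h1]
    have := mul_le_mul_of_nonneg_left hjac (sq_nonneg φ)
    linarith
  have h5 : 6 * w * S ≤ 2 * w / (1 + w ^ 2) * (4 * w ^ 2 * S) := by
    have e : 2 * w / (1 + w ^ 2) * (4 * w ^ 2 * S) = (w * S) * (8 * w ^ 2 / (1 + w ^ 2)) := by
      field_simp; ring
    -- This is `3 ≤ w²`.
    have h6 : 6 ≤ 8 * w ^ 2 / (1 + w ^ 2) := by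
      rw [le_div_iff₀ (by positivity)]; linarith
    rw [e]
    have := mul_le_mul_of_nonneg_left h6 (mul_nonneg hw.le hS0)
    linarith
  have h6 : 2 * φ * w * (φt - ∑ i, G i * φii i) < 0 :=
    mul_neg_of_pos_of_neg (by positivity) hcut
  linarith

end Evolution

/-! ### The cutoff function -/

section Cutoff

open Filter Topology

variable {n : ℕ}

theorem sum_sq_apply_eq (b : OrthonormalBasis (Fin n) ℝ (EuclideanSpace ℝ (Fin n)))
    (l : EuclideanSpace ℝ (Fin n) →L[ℝ] ℝ) : ∑ k, l (b k) ^ 2 = ‖l‖ ^ 2 := by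
  set y := (InnerProductSpace.toDual ℝ (EuclideanSpace ℝ (Fin n))).symm l with hy
  have h1 : ∀ v, l v = inner ℝ y v := fun v => by
    rw [hy, InnerProductSpace.toDual_symm_apply]
  have h2 : ‖l‖ = ‖y‖ := by rw [hy, LinearIsometryEquiv.norm_map]
  simp_rw [h1]
  rw [h2, ← b.sum_sq_norm_inner_left y]
  refine Finset.sum_congr rfl fun k _ => ?_
  rw [Real.norm_eq_abs, sq_abs]

theorem bilinear_apply_eq_sum (b : OrthonormalBasis (Fin n) ℝ (EuclideanSpace ℝ (Fin n)))
    (B : EuclideanSpace ℝ (Fin n) →L[ℝ] EuclideanSpace ℝ (Fin n) →L[ℝ] ℝ)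
    (v w : EuclideanSpace ℝ (Fin n)) :
    B v w = ∑ i, ∑ j, inner ℝ (b i) v * inner ℝ (b j) w * B (b i) (b j) := by
  conv_lhs => rw [← b.sum_repr' v, ← b.sum_repr' w]
  simp only [map_sum, map_smul, _root_.sum_apply, _root_.smul_apply,
    smul_eq_mul, Finset.mul_sum]
  rw [Finset.sum_comm]
  refine Finset.sum_congr rfl fun i _ => Finset.sum_congr rfl fun j _ => ?_
  ring

/-- The spatial differential `Df(x,t)` of a function of space and time. -/
noncomputable def spaceDeriv (f : EuclideanSpace ℝ (Fin n) × ℝ → ℝ)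
    (q : EuclideanSpace ℝ (Fin n) × ℝ) : EuclideanSpace ℝ (Fin n) →L[ℝ] ℝ :=
  (fderiv ℝ f q).comp (ContinuousLinearMap.inl ℝ (EuclideanSpace ℝ (Fin n)) ℝ)

/-- The cutoff `φ = n² t - |x|² + K |Df|² - 4n/5`. The dimension `n` is read off from the type; the
constant `4n/5` exceeds the bound `39n/50` for `K |Df|²`, so that `φ < 0` at small times. -/
noncomputable def cutoff (K : ℝ) (f : EuclideanSpace ℝ (Fin n) × ℝ → ℝ)
    (q : EuclideanSpace ℝ (Fin n) × ℝ) : ℝ :=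
  (n : ℝ) ^ 2 * q.2 - ‖q.1‖ ^ 2 + K * ‖spaceDeriv f q‖ ^ 2 - 4 / 5 * n

/-- The cutoff in terms of directional derivatives in an arbitrary orthonormal basis. -/
theorem cutoff_eq (b : OrthonormalBasis (Fin n) ℝ (EuclideanSpace ℝ (Fin n))) (K : ℝ)
    (f : EuclideanSpace ℝ (Fin n) × ℝ → ℝ) :
    cutoff K f = fun q => ((n : ℝ) ^ 2 * q.2 +
      (-1) * ∑ k, (((innerSL ℝ (b k)).comp
        (ContinuousLinearMap.fst ℝ (EuclideanSpace ℝ (Fin n)) ℝ)) q) ^ 2)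
      + (K * (∑ k, dirDeriv ((b k, 0) : EuclideanSpace ℝ (Fin n) × ℝ) f q ^ 2)
        + -(4 / 5 * (n : ℝ))) := by
  funext q
  have h1 : ∑ k, dirDeriv ((b k, 0) : EuclideanSpace ℝ (Fin n) × ℝ) f q ^ 2
      = ‖spaceDeriv f q‖ ^ 2 := by
    rw [← sum_sq_apply_eq b]
    simp [spaceDeriv, dirDeriv]
  have h2 : ∑ k, (((innerSL ℝ (b k)).comp
      (ContinuousLinearMap.fst ℝ (EuclideanSpace ℝ (Fin n)) ℝ)) q) ^ 2 = ‖q.1‖ ^ 2 := by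
    rw [← b.sum_sq_norm_inner_right q.1]
    refine Finset.sum_congr rfl fun k _ => ?_
    simp [sq_abs]
  rw [h1, h2, cutoff]
  ring

variable {U : Set (EuclideanSpace ℝ (Fin n) × ℝ)} {f : EuclideanSpace ℝ (Fin n) × ℝ → ℝ}
  {p : EuclideanSpace ℝ (Fin n) × ℝ}

theorem contDiffOn_cutoff (hU : IsOpen U) (hf : ContDiffOn ℝ ∞ f U) (K : ℝ) :
    ContDiffOn ℝ ∞ (cutoff K f) U := by
  rw [cutoff_eq (EuclideanSpace.basisFun (Fin n) ℝ)]
  refine ((contDiffOn_const.mul contDiff_snd.contDiffOn).add (contDiffOn_const.mul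
    (ContDiffOn.sum fun k _ => (ContinuousLinearMap.contDiff _).contDiffOn.pow 2))).add
    ((contDiffOn_const.mul (ContDiffOn.sum fun k _ => (hf.dirDeriv hU _).pow 2)).add
      contDiffOn_const)

/-- The heat operator of the induced metric applied to the cutoff. -/
theorem heat_cutoff (b : OrthonormalBasis (Fin n) ℝ (EuclideanSpace ℝ (Fin n))) (hU : IsOpen U)
    (hf : ContDiffOn ℝ ∞ f U) {c : ℝ} (K : ℝ)
    (him : ∀ q ∈ U, ((oneAddI (hessMatrix (fun i => (b i, (0 : ℝ))) f q)).det *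
      Complex.exp (-((dirDeriv (0, 1) f q + c : ℝ) * Complex.I))).im = 0)
    (hp : p ∈ U) {l : Fin n → ℝ}
    (hd : hessMatrix (fun i => (b i, (0 : ℝ))) f p = Matrix.diagonal l) :
    dirDeriv (0, 1) (cutoff K f) p
      - ∑ i, (1 + l i ^ 2)⁻¹ * dirDeriv (b i, 0) (dirDeriv (b i, 0) (cutoff K f)) p
      = (n : ℝ) ^ 2 + ∑ i, (2 - 2 * K * l i ^ 2) / (1 + l i ^ 2) := by
  set L : Fin n → (EuclideanSpace ℝ (Fin n) × ℝ →L[ℝ] ℝ) := fun k =>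
    (innerSL ℝ (b k)).comp (ContinuousLinearMap.fst ℝ (EuclideanSpace ℝ (Fin n)) ℝ) with hL
  set X : EuclideanSpace ℝ (Fin n) × ℝ → ℝ := fun q => ∑ k, L k q ^ 2 with hX
  set D : EuclideanSpace ℝ (Fin n) × ℝ → ℝ := fun q => ∑ k, dirDeriv (b k, 0) f q ^ 2 with hD
  set t : EuclideanSpace ℝ (Fin n) × ℝ →L[ℝ] ℝ :=
    ContinuousLinearMap.snd ℝ (EuclideanSpace ℝ (Fin n)) ℝ with ht
  have hLs : ∀ k, ContDiffOn ℝ ∞ (fun q => L k q) U := fun k => (L k).contDiff.contDiffOn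
  have hXs : ContDiffOn ℝ ∞ X U := ContDiffOn.sum fun k _ => (hLs k).pow 2
  have hDs : ContDiffOn ℝ ∞ D U := ContDiffOn.sum fun k _ => (hf.dirDeriv hU _).pow 2
  have hts : ContDiffOn ℝ ∞ (fun q => t q) U := t.contDiff.contDiffOn
  have e : cutoff K f = fun q => ((n : ℝ) ^ 2 * t q + (-1) * X q)
      + (K * D q + -(4 / 5 * (n : ℝ))) := cutoff_eq b K f
  have ha : ContDiffOn ℝ ∞ (fun q => (n : ℝ) ^ 2 * t q) U := contDiffOn_const.mul hts
  have hb : ContDiffOn ℝ ∞ (fun q => (-1) * X q) U := contDiffOn_const.mul hXs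
  have hc : ContDiffOn ℝ ∞ (fun q => K * D q) U := contDiffOn_const.mul hDs
  have hk : ContDiffOn ℝ ∞ (fun _ : EuclideanSpace ℝ (Fin n) × ℝ => -(4 / 5 * (n : ℝ))) U :=
    contDiffOn_const
  have hconst : ∀ (v q : EuclideanSpace ℝ (Fin n) × ℝ) (r : ℝ), dirDeriv v (fun _ => r) q = 0 := by
    intro v q r; simp [dirDeriv]
  have hconst2 : ∀ (v q : EuclideanSpace ℝ (Fin n) × ℝ) (r : ℝ),
      dirDeriv v (dirDeriv v fun _ => r) q = 0 := by
    intro v q r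
    have : dirDeriv v (fun _ : EuclideanSpace ℝ (Fin n) × ℝ => r) = fun _ => 0 :=
      funext fun q => hconst v q r
    rw [this, hconst]
  have hd' : ∀ {g : EuclideanSpace ℝ (Fin n) × ℝ → ℝ}, ContDiffOn ℝ ∞ g U →
      DifferentiableAt ℝ g p :=
    fun hg => hg.differentiableAt_of_isOpen hU hp
  have hXt : dirDeriv (0, 1) X p = 0 := by
    rw [hX, dirDeriv_sum fun k _ => hd' ((hLs k).pow 2)]
    refine Finset.sum_eq_zero fun k _ => ?_
    rw [dirDeriv_sq (hd' (hLs k)), dirDeriv_clm]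
    simp [hL]
  have hXi : ∀ i, dirDeriv (b i, 0) (dirDeriv (b i, 0) X) p = 2 := by
    intro i
    rw [hX, dirDeriv_dirDeriv_sum hU (fun k => (hLs k).pow 2) hp]
    simp_rw [fun k => dirDeriv_dirDeriv_sq hU (hLs k) hp (b i, (0 : ℝ)), dirDeriv_clm,
      dirDeriv_dirDeriv_clm]
    rw [Finset.sum_eq_single i (fun k _ hk => by simp [hL, b.inner_eq_zero hk]) (by simp)]
    simp [hL]
  have h1 : dirDeriv (0, 1) (cutoff K f) p = (n : ℝ) ^ 2 + K * dirDeriv (0, 1) D p := by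
    rw [e, dirDeriv_add (hd' (ha.add hb)) (hd' (hc.add hk)), dirDeriv_add (hd' ha) (hd' hb),
      dirDeriv_add (hd' hc) (hd' hk), dirDeriv_const_mul (hd' hts), dirDeriv_const_mul (hd' hXs),
      dirDeriv_const_mul (hd' hDs), hconst, hXt, dirDeriv_clm]
    simp [ht]
  have h2 : ∀ i, dirDeriv (b i, 0) (dirDeriv (b i, 0) (cutoff K f)) p
      = -2 + K * dirDeriv (b i, 0) (dirDeriv (b i, 0) D) p := by
    intro i
    rw [e, dirDeriv_dirDeriv_add hU (ha.add hb) (hc.add hk) hp, dirDeriv_dirDeriv_add hU ha hb hp,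
      dirDeriv_dirDeriv_add hU hc hk hp, dirDeriv_dirDeriv_const_mul hU hts hp,
      dirDeriv_dirDeriv_const_mul hU hXs hp, dirDeriv_dirDeriv_const_mul hU hDs hp, hconst2, hXi,
      dirDeriv_dirDeriv_clm]
    ring
  have h3 := heat_gradient_sq hU hf him hp hd
  simp_rw [h1, h2]
  have h4 : ∑ i, (1 + l i ^ 2)⁻¹ * (-2 + K * dirDeriv (b i, 0) (dirDeriv (b i, 0) D) p)
      = -∑ i, 2 / (1 + l i ^ 2)
        + K * ∑ i, dirDeriv (b i, 0) (dirDeriv (b i, 0) D) p / (1 + l i ^ 2) := by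
    rw [Finset.mul_sum, ← Finset.sum_neg_distrib, ← Finset.sum_add_distrib]
    refine Finset.sum_congr rfl fun i _ => ?_
    ring
  have h5 : ∑ i, (2 - 2 * K * l i ^ 2) / (1 + l i ^ 2)
      = ∑ i, 2 / (1 + l i ^ 2) + K * -∑ i, 2 * l i ^ 2 / (1 + l i ^ 2) := by
    rw [← Finset.sum_neg_distrib, Finset.mul_sum, ← Finset.sum_add_distrib]
    refine Finset.sum_congr rfl fun i _ => ?_
    ring
  rw [h4, h5, ← h3]
  ring

/-- The cutoff is a strict subsolution wherever one eigenvalue is large: that eigenvalue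
contributes almost `-2K`, each of the others at most `2`. -/
theorem cutoff_rate_neg {l : Fin n → ℝ} {K : ℝ} (hK : K = (n : ℝ) ^ 2 / 2 + n) (m : Fin n)
    (hm : K < l m ^ 2) : (n : ℝ) ^ 2 + ∑ i, (2 - 2 * K * l i ^ 2) / (1 + l i ^ 2) < 0 := by
  have hK0 : 0 ≤ K := by rw [hK]; positivity
  have h1 : ∀ i, (2 - 2 * K * l i ^ 2) / (1 + l i ^ 2) ≤ 2 := by
    intro i
    rw [div_le_iff₀ (by positivity)]
    have : 0 ≤ K * l i ^ 2 := by positivity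
    have := sq_nonneg (l i)
    linarith
  have h2 : (2 - 2 * K * l m ^ 2) / (1 + l m ^ 2) < 2 - 2 * K := by
    rw [div_lt_iff₀ (by positivity)]
    linarith
  have h3 : ∑ i, (2 - 2 * K * l i ^ 2) / (1 + l i ^ 2) < 2 * n - 2 * K := by
    rw [← Finset.add_sum_erase _ _ (Finset.mem_univ m)]
    have h4 : ∑ i ∈ Finset.univ.erase m, (2 - 2 * K * l i ^ 2) / (1 + l i ^ 2)
        ≤ ∑ _i ∈ Finset.univ.erase m, (2 : ℝ) := Finset.sum_le_sum fun i _ => h1 i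
    have h5 : ∑ _i ∈ Finset.univ.erase m, (2 : ℝ) = 2 * n - 2 := by
      rw [Finset.sum_erase_eq_sub (Finset.mem_univ m)]
      simp; ring
    linarith
  have : (n : ℝ) ^ 2 = 2 * K - 2 * n := by rw [hK]; ring
  linarith

/-- `φ² ∂ₘ∂ₘf` has no maximum with respect to earlier times at a point where the top eigenvalue
`∂ₘ∂ₘf` is large. -/
theorem not_parabolic_max (b : OrthonormalBasis (Fin n) ℝ (EuclideanSpace ℝ (Fin n)))
    (hU : IsOpen U) (hf : ContDiffOn ℝ ∞ f U) {c K : ℝ} (hK : K = (n : ℝ) ^ 2 / 2 + n)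
    (him : ∀ q ∈ U, ((oneAddI (hessMatrix (fun i => (b i, (0 : ℝ))) f q)).det *
      Complex.exp (-((dirDeriv (0, 1) f q + c : ℝ) * Complex.I))).im = 0)
    (hp : p ∈ U) {l : Fin n → ℝ}
    (hd : hessMatrix (fun i => (b i, (0 : ℝ))) f p = Matrix.diagonal l) (hl : ∀ i, 0 ≤ l i)
    (m : Fin n) (hm : K + 3 < l m) (hφ : 0 < cutoff K f p)
    {h : EuclideanSpace ℝ (Fin n) × ℝ → ℝ}
    (hh : h = fun q => cutoff K f q ^ 2 * dirDeriv (b m, 0) (dirDeriv (b m, 0) f) q)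
    (hspace : ∀ i, IsLocalMax (fun s : ℝ => h (p + s • (b i, (0 : ℝ)))) 0)
    (htime : ∀ᶠ s : ℝ in 𝓝[<] 0, h (p + s • (0, (1 : ℝ))) ≤ h p) : False := by
  have hK0 : 0 ≤ K := by rw [hK]; positivity
  have hφs := contDiffOn_cutoff hU hf K
  set w := dirDeriv (b m, (0 : ℝ)) (dirDeriv (b m, (0 : ℝ)) f) with hw
  have hws : ContDiffOn ℝ ∞ w U := (hf.dirDeriv hU _).dirDeriv hU _
  have hhs : ContDiffOn ℝ ∞ h U := by rw [hh]; exact (hφs.pow 2).mul hws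
  have hwp : w p = l m := by
    have : hessMatrix (fun i => (b i, (0 : ℝ))) f p m m = Matrix.diagonal l m m := by rw [hd]
    rwa [Matrix.diagonal_apply_eq] at this
  have hd1 := hφs.differentiableAt_of_isOpen hU hp
  have hd2 := hws.differentiableAt_of_isOpen hU hp
  have hi := fun i => dirDeriv_of_isLocalMax_line hU hhs hp (hspace i)
  have ht : 0 ≤ dirDeriv (0, 1) h p := by
    have h1 := hasDerivAt_line_zero (v := ((0, 1) : EuclideanSpace ℝ (Fin n) × ℝ))
      (hhs.differentiableAt_of_isOpen hU hp)
    have h2 := (hasDerivAt_iff_tendsto_slope.1 h1).mono_left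
      (nhdsWithin_mono (0 : ℝ) (show Iio (0 : ℝ) ⊆ {0}ᶜ from fun x hx => ne_of_lt hx))
    refine ge_of_tendsto h2 ?_
    filter_upwards [htime, self_mem_nhdsWithin] with s hs hs0
    have hs0' : s < 0 := hs0
    rw [slope_def_field]
    refine div_nonneg_of_nonpos ?_ (by linarith)
    simpa using hs
  have hjac := jacobi_inequality hU hf him hp hd hl m
  have hcut := heat_cutoff b hU hf K him hp hd
  refine false_of_maximum_conditions (φ := cutoff K f p) (w := l m)
    (φt := dirDeriv (0, 1) (cutoff K f) p) (wt := dirDeriv (0, 1) w p)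
    (G := fun i => (1 + l i ^ 2)⁻¹)
    (φi := fun i => dirDeriv (b i, 0) (cutoff K f) p) (wi := fun i => dirDeriv (b i, 0) w p)
    (φii := fun i => dirDeriv (b i, 0) (dirDeriv (b i, 0) (cutoff K f)) p)
    (wii := fun i => dirDeriv (b i, 0) (dirDeriv (b i, 0) w) p) hφ (by linarith)
    (by nlinarith) (fun i => by positivity) ?_ (fun i => ?_) (fun i => ?_) ?_ ?_
  · rw [hh, dirDeriv_sq_mul hd1 hd2, hwp] at ht
    linarith
  · have := (hi i).1
    rw [hh, dirDeriv_sq_mul hd1 hd2, hwp] at this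
    linarith
  · have := (hi i).2
    rw [hh, dirDeriv_dirDeriv_sq_mul hU hφs hws hp, hwp] at this
    linarith
  · simpa only [div_eq_inv_mul] using hjac
  · rw [hcut]
    exact cutoff_rate_neg hK m (by nlinarith)

end Cutoff

/-! ### The maximum principle -/

section MaximumPrinciple

open Filter Topology

variable {n : ℕ}

theorem exists_orthonormalBasis_diagonal
    (B : EuclideanSpace ℝ (Fin n) →L[ℝ] EuclideanSpace ℝ (Fin n) →L[ℝ] ℝ)
    (hB : ∀ v w, B v w = B w v) :
    ∃ (b : OrthonormalBasis (Fin n) ℝ (EuclideanSpace ℝ (Fin n))) (l : Fin n → ℝ),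
      ∀ i j, B (b i) (b j) = Matrix.diagonal l i j := by
  set T : EuclideanSpace ℝ (Fin n) →ₗ[ℝ] EuclideanSpace ℝ (Fin n) :=
    ((InnerProductSpace.toDual ℝ (EuclideanSpace ℝ (Fin n))).symm.toLinearEquiv.toLinearMap).comp
      B.toLinearMap with hTdef
  have hTB : ∀ v w, inner ℝ (T v) w = B v w := fun v w => by
    rw [hTdef]
    exact InnerProductSpace.toDual_symm_apply
  have hT : T.IsSymmetric := fun v w => by
    rw [hTB, real_inner_comm, hTB, hB]
  refine ⟨hT.eigenvectorBasis (by simp), hT.eigenvalues (by simp), fun i j => ?_⟩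
  rw [← hTB, hT.apply_eigenvectorBasis, inner_smul_left, Matrix.diagonal_apply]
  by_cases h : i = j
  · subst h; simp
  · rw [(hT.eigenvectorBasis (by simp)).inner_eq_zero h]; simp [h]

theorem apply_self_le_of_diagonal {b : OrthonormalBasis (Fin n) ℝ (EuclideanSpace ℝ (Fin n))}
    {l : Fin n → ℝ} {B : EuclideanSpace ℝ (Fin n) →L[ℝ] EuclideanSpace ℝ (Fin n) →L[ℝ] ℝ}
    (hB : ∀ i j, B (b i) (b j) = Matrix.diagonal l i j) {m : Fin n} (hm : ∀ i, l i ≤ l m)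
    {v : EuclideanSpace ℝ (Fin n)} (hv : ‖v‖ = 1) : B v v ≤ l m := by
  have h1 : B v v = ∑ i, l i * inner ℝ (b i) v ^ 2 := by
    rw [bilinear_apply_eq_sum b]
    refine Finset.sum_congr rfl fun i _ => ?_
    rw [Finset.sum_eq_single i (fun j _ hj => by
      rw [hB, Matrix.diagonal_apply_ne' l hj, mul_zero]) (by simp), hB, Matrix.diagonal_apply_eq]
    ring
  have h2 : ∑ i, inner ℝ (b i) v ^ 2 = 1 := by
    have := b.sum_sq_norm_inner_right v
    rw [hv] at this
    simpa [sq_abs] using this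
  calc B v v = ∑ i, l i * inner ℝ (b i) v ^ 2 := h1
    _ ≤ ∑ i, l m * inner ℝ (b i) v ^ 2 :=
        Finset.sum_le_sum fun i _ => mul_le_mul_of_nonneg_right (hm i) (sq_nonneg _)
    _ = l m := by rw [← Finset.mul_sum, h2, mul_one]

/-- The spatial Hessian `D²f(x,t)` of a function of space and time, as a bilinear form. -/
noncomputable def spaceHess (f : EuclideanSpace ℝ (Fin n) × ℝ → ℝ)
    (q : EuclideanSpace ℝ (Fin n) × ℝ) :
    EuclideanSpace ℝ (Fin n) →L[ℝ] EuclideanSpace ℝ (Fin n) →L[ℝ] ℝ :=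
  (fderiv ℝ (fderiv ℝ f) q).bilinearComp
    (ContinuousLinearMap.inl ℝ (EuclideanSpace ℝ (Fin n)) ℝ)
    (ContinuousLinearMap.inl ℝ (EuclideanSpace ℝ (Fin n)) ℝ)

variable {U : Set (EuclideanSpace ℝ (Fin n) × ℝ)} {f : EuclideanSpace ℝ (Fin n) × ℝ → ℝ}
  {p : EuclideanSpace ℝ (Fin n) × ℝ}

theorem spaceHess_apply (hU : IsOpen U) (hf : ContDiffOn ℝ ∞ f U) (hp : p ∈ U)
    (v w : EuclideanSpace ℝ (Fin n)) :
    spaceHess f p v w = dirDeriv (v, 0) (dirDeriv (w, 0) f) p := by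
  rw [dirDeriv_dirDeriv_eq hf hU hp]
  simp [spaceHess]

/-- The interior estimate at positive times before the final one, on the set where the cutoff is
positive. -/
theorem cutoff_sq_mul_spaceHess_le (hn : 1 ≤ n) {r c K : ℝ} (hr : Real.sqrt n < r)
    (hK : K = (n : ℝ) ^ 2 / 2 + n) (hUdef : U = ball 0 r ×ˢ Ioo 0 (1 / (n : ℝ)))
    (hf : ContDiffOn ℝ ∞ f U)
    (him : ∀ b : OrthonormalBasis (Fin n) ℝ (EuclideanSpace ℝ (Fin n)), ∀ q ∈ U,
      ((oneAddI (hessMatrix (fun i => (b i, (0 : ℝ))) f q)).det *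
        Complex.exp (-((dirDeriv (0, 1) f q + c : ℝ) * Complex.I))).im = 0)
    (hconv : ∀ q ∈ U, ∀ v, 0 ≤ spaceHess f q v v)
    (hgrad : ∀ q ∈ U, ‖q.1‖ ≤ Real.sqrt n → ‖spaceDeriv f q‖ ^ 2 ≤ 13 / (25 * n))
    {q₁ : EuclideanSpace ℝ (Fin n) × ℝ} (hq₁ : q₁ ∈ U) (hx₁ : ‖q₁.1‖ ≤ Real.sqrt n)
    (hφ₁ : 0 < cutoff K f q₁) {v₁ : EuclideanSpace ℝ (Fin n)} (hv₁ : ‖v₁‖ = 1) :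
    cutoff K f q₁ ^ 2 * spaceHess f q₁ v₁ v₁ ≤ (n : ℝ) ^ 2 * (K + 3) := by
  by_contra! hbig
  have hn0 : (0 : ℝ) < n := by exact_mod_cast hn
  have hn1 : (1 : ℝ) ≤ n := by exact_mod_cast hn
  have hK0 : 0 ≤ K := by rw [hK]; positivity
  have hU : IsOpen U := by rw [hUdef]; exact isOpen_ball.prod isOpen_Ioo
  have hmem : ∀ q : EuclideanSpace ℝ (Fin n) × ℝ, q ∈ U ↔ ‖q.1‖ < r ∧ 0 < q.2 ∧ q.2 < 1 / n := by
    intro q; rw [hUdef]; simp [mem_prod]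
  have hφs := contDiffOn_cutoff hU hf K
  -- The gradient term of the cutoff is at most `39n/50`.
  have hub : ∀ q ∈ U, ‖q.1‖ ≤ Real.sqrt n →
      cutoff K f q ≤ (n : ℝ) ^ 2 * q.2 - ‖q.1‖ ^ 2 - n / 50 := by
    intro q hq hx
    have h1 : K * ‖spaceDeriv f q‖ ^ 2 ≤ K * (13 / (25 * n)) :=
      mul_le_mul_of_nonneg_left (hgrad q hq hx) hK0
    have h2 : K * (13 / (25 * n)) = 13 / 50 * n + 13 / 25 := by
      rw [hK]; field_simp; ring
    rw [cutoff]
    linarith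
  have htn : ∀ q ∈ U, (n : ℝ) ^ 2 * q.2 < n := by
    intro q hq
    have := ((hmem q).1 hq).2.2
    rw [lt_div_iff₀ hn0] at this
    nlinarith
  have hpos : ∀ q ∈ U, ‖q.1‖ ≤ Real.sqrt n → 0 < cutoff K f q →
      ‖q.1‖ < Real.sqrt n ∧ 1 / (50 * n) < q.2 ∧ cutoff K f q < n := by
    intro q hq hx hφ
    have h1 := hub q hq hx
    have h2 := htn q hq
    have h3 := sq_nonneg ‖q.1‖
    refine ⟨Real.lt_sqrt_of_sq_lt (by linarith), ?_, by linarith⟩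
    rw [div_lt_iff₀ (by positivity)]
    have : n / 50 < (n : ℝ) ^ 2 * q.2 := by linarith
    nlinarith
  obtain ⟨-, ht₁, -⟩ := hpos q₁ hq₁ hx₁ hφ₁
  set S : Set (EuclideanSpace ℝ (Fin n) × ℝ) :=
    closedBall 0 (Real.sqrt n) ×ˢ Icc (1 / (50 * (n : ℝ))) q₁.2 with hS
  have hSU : S ⊆ U := by
    rintro q ⟨hq1, hq2⟩
    rw [hmem]
    have : ‖q.1‖ ≤ Real.sqrt n := by simpa using hq1
    have h0 : (0 : ℝ) < 1 / (50 * n) := by positivity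
    exact ⟨this.trans_lt hr, h0.trans_le hq2.1, hq2.2.trans_lt ((hmem q₁).1 hq₁).2.2⟩
  have hScomp : IsCompact (S ×ˢ sphere (0 : EuclideanSpace ℝ (Fin n)) 1) :=
    ((isCompact_closedBall _ _).prod isCompact_Icc).prod (isCompact_sphere _ _)
  have hcont : ContinuousOn (fun z : (EuclideanSpace ℝ (Fin n) × ℝ) × EuclideanSpace ℝ (Fin n) =>
      max (cutoff K f z.1) 0 ^ 2 * spaceHess f z.1 z.2 z.2) (S ×ˢ sphere 0 1) := by
    have h1 : ContinuousOn (cutoff K f) U := hφs.continuousOn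
    have h2 : ContinuousOn (fderiv ℝ (fderiv ℝ f)) U :=
      ((hf.fderiv_of_isOpen hU (m := ∞) (by simp)).fderiv_of_isOpen hU (m := ∞)
        (by simp)).continuousOn
    have hm : MapsTo (Prod.fst : (EuclideanSpace ℝ (Fin n) × ℝ) × EuclideanSpace ℝ (Fin n) → _)
        (S ×ˢ sphere 0 1) U := fun z hz => hSU hz.1
    have h1' := h1.comp continuous_fst.continuousOn hm
    have h2' := h2.comp continuous_fst.continuousOn hm
    have hv : ContinuousOn (fun z : (EuclideanSpace ℝ (Fin n) × ℝ) × EuclideanSpace ℝ (Fin n) =>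
        ((z.2, 0) : EuclideanSpace ℝ (Fin n) × ℝ)) (S ×ˢ sphere 0 1) := by fun_prop
    have hpos' : Continuous fun a : ℝ => max a 0 := by fun_prop
    have h3 := ((hpos'.comp_continuousOn h1').pow 2).mul ((h2'.clm_apply hv).clm_apply hv)
    exact h3.congr fun z _ => by simp [spaceHess]
  obtain ⟨⟨p, v₀⟩, ⟨hpS, hv₀⟩, hmax⟩ := hScomp.exists_isMaxOn
    ⟨(q₁, v₁), ⟨⟨by simpa using hx₁, ht₁.le, le_rfl⟩, by simpa using hv₁⟩⟩ hcont
  have hv₀' : ‖v₀‖ = 1 := by simpa using hv₀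
  have hmax' : ∀ q ∈ S, ∀ v, ‖v‖ = 1 → max (cutoff K f q) 0 ^ 2 * spaceHess f q v v
      ≤ max (cutoff K f p) 0 ^ 2 * spaceHess f p v₀ v₀ := fun q hq v hv =>
    hmax (show (q, v) ∈ S ×ˢ sphere 0 1 from ⟨hq, by simpa using hv⟩)
  have hval : (n : ℝ) ^ 2 * (K + 3) < max (cutoff K f p) 0 ^ 2 * spaceHess f p v₀ v₀ := by
    refine hbig.trans_le ?_
    have := hmax' q₁ ⟨by simpa using hx₁, ht₁.le, le_rfl⟩ v₁ hv₁
    rwa [max_eq_left hφ₁.le] at this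
  have hpU := hSU hpS
  have hxp : ‖p.1‖ ≤ Real.sqrt n := by simpa using hpS.1
  have hφp : 0 < cutoff K f p := by
    by_contra! h
    rw [max_eq_right h] at hval
    have : (0 : ℝ) < (n : ℝ) ^ 2 * (K + 3) := by positivity
    simp only [ne_eq, OfNat.ofNat_ne_zero, not_false_eq_true, zero_pow, zero_mul] at hval
    linarith
  obtain ⟨hxp', htp, hφn⟩ := hpos p hpU hxp hφp
  rw [max_eq_left hφp.le] at hval hmax'
  -- Replace the maximizing direction by an eigenvector for the top eigenvalue.
  obtain ⟨b, l, hbl⟩ := exists_orthonormalBasis_diagonal (spaceHess f p) fun v w => by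
    rw [spaceHess_apply hU hf hpU, spaceHess_apply hU hf hpU, dirDeriv_comm hf hU hpU]
  have hl : ∀ i, 0 ≤ l i := fun i => by
    have := hconv p hpU (b i)
    rwa [hbl, Matrix.diagonal_apply_eq] at this
  have : Nonempty (Fin n) := ⟨⟨0, hn⟩⟩
  obtain ⟨m, hm⟩ := Finite.exists_max l
  have hle : spaceHess f p v₀ v₀ ≤ l m := apply_self_le_of_diagonal hbl hm hv₀'
  have hφsq : cutoff K f p ^ 2 ≤ (n : ℝ) ^ 2 := pow_le_pow_left₀ hφp.le hφn.le 2
  have hlm : K + 3 < l m := by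
    by_contra! h
    have h1 := mul_le_mul_of_nonneg_left hle (sq_nonneg (cutoff K f p))
    have h2 := mul_le_mul hφsq h (hl m) (sq_nonneg (n : ℝ))
    linarith
  have hd : hessMatrix (fun i => (b i, (0 : ℝ))) f p = Matrix.diagonal l := by
    ext i j
    rw [← hbl, spaceHess_apply hU hf hpU]
    rfl
  set h : EuclideanSpace ℝ (Fin n) × ℝ → ℝ :=
    fun q => cutoff K f q ^ 2 * dirDeriv (b m, 0) (dirDeriv (b m, 0) f) q with hh
  have hhp : h p = cutoff K f p ^ 2 * l m := by
    have := hbl m m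
    rw [spaceHess_apply hU hf hpU, Matrix.diagonal_apply_eq] at this
    rw [hh]
    simp only
    rw [this]
  have hle' : ∀ q ∈ S, 0 < cutoff K f q → h q ≤ h p := by
    intro q hq hφq
    have h1 := hmax' q hq (b m) (b.norm_eq_one m)
    rw [max_eq_left hφq.le, spaceHess_apply hU hf (hSU hq)] at h1
    rw [hhp]
    exact h1.trans (mul_le_mul_of_nonneg_left hle (sq_nonneg _))
  have hφev : ∀ v : EuclideanSpace ℝ (Fin n) × ℝ,
      ∀ᶠ s : ℝ in 𝓝 0, 0 < cutoff K f (p + s • v) := by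
    intro v
    have hc := (hasDerivAt_line_zero (v := v)
      (hφs.differentiableAt_of_isOpen hU hpU)).continuousAt
    exact hc.eventually (lt_mem_nhds (by simpa using hφp))
  refine not_parabolic_max b hU hf hK (him b) hpU hd hl m hlm hφp hh (fun i => ?_) ?_
  · have hball : ∀ᶠ s : ℝ in 𝓝 0, ‖p.1 + s • b i‖ < Real.sqrt n := by
      have hc : ContinuousAt (fun s : ℝ => ‖p.1 + s • b i‖) 0 := by fun_prop
      exact hc.eventually (gt_mem_nhds (by simpa using hxp'))
    filter_upwards [hball, hφev (b i, 0)] with s hs1 hs2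
    have : h (p + s • (b i, (0 : ℝ))) ≤ h p :=
      hle' _ ⟨by simpa using hs1.le, by simpa using hpS.2⟩ hs2
    simpa using this
  · have htime : ∀ᶠ s : ℝ in 𝓝 0, 1 / (50 * (n : ℝ)) < p.2 + s := by
      have hc : ContinuousAt (fun s : ℝ => p.2 + s) 0 := by fun_prop
      exact hc.eventually (lt_mem_nhds (by simpa using htp))
    filter_upwards [nhdsWithin_le_nhds htime, nhdsWithin_le_nhds (hφev (0, 1)),
      self_mem_nhdsWithin] with s hs1 hs2 hs3
    have hs3' : s < 0 := hs3
    refine hle' _ ⟨by simpa using hxp, ?_, ?_⟩ hs2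
    · simpa using hs1.le
    · have := hpS.2.2
      simp only [Prod.snd_add, Prod.smul_snd, smul_eq_mul, mul_one]
      linarith

end MaximumPrinciple

/-! ### Convex functions and Hessians -/

section Convexity

open Filter Topology

theorem ConvexOn.add_fderiv_le {V : Type*} [NormedAddCommGroup V] [NormedSpace ℝ V] {s : Set V}
    {g : V → ℝ} {x y : V} (hg : ConvexOn ℝ s g) (hd : DifferentiableAt ℝ g x) (hx : x ∈ s)
    (hy : y ∈ s) : g x + fderiv ℝ g x (y - x) ≤ g y := by
  have hc := hg.comp_affineMap (AffineMap.lineMap x y : ℝ →ᵃ[ℝ] V)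
  have hder : HasDerivAt (g ∘ (AffineMap.lineMap x y : ℝ →ᵃ[ℝ] V)) (fderiv ℝ g x (y - x)) 0 := by
    have h1 : HasFDerivAt g (fderiv ℝ g x) ((AffineMap.lineMap x y : ℝ →ᵃ[ℝ] V) 0) := by
      simpa using hd.hasFDerivAt
    exact h1.comp_hasDerivAt 0 AffineMap.hasDerivAt_lineMap
  have := hc.le_slope_of_hasDerivAt (x := 0) (y := 1) (by simpa using hx) (by simpa using hy)
    one_pos hder
  simp only [slope_def_field, Function.comp_apply, AffineMap.lineMap_apply_one,
    AffineMap.lineMap_apply_zero, sub_zero, div_one] at this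
  linarith

theorem ConvexOn.dirDeriv_dirDeriv_nonneg {V : Type*} [NormedAddCommGroup V] [NormedSpace ℝ V]
    {s : Set V} {g : V → ℝ} {x : V} (hg : ConvexOn ℝ s g) (hs : IsOpen s)
    (hsm : ContDiffOn ℝ ∞ g s) (hx : x ∈ s) (v : V) : 0 ≤ dirDeriv v (dirDeriv v g) x := by
  -- The tangent at `x` minus `g` has a maximum at `x`.
  have h1 : ContDiffOn ℝ ∞ (fun q => fderiv ℝ g x q) s := (fderiv ℝ g x).contDiff.contDiffOn
  have h2 : ContDiffOn ℝ ∞ (fun q => (-1) * g q) s := contDiffOn_const.mul hsm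
  have hmax : IsLocalMax (fun r : ℝ =>
      (fun q => (-1) * g q + fderiv ℝ g x q) (x + r • v)) 0 := by
    filter_upwards [eventually_line_mem hs hx v] with r hr
    have := hg.add_fderiv_le (hsm.differentiableAt_of_isOpen hs hx) hx hr
    simp only [add_sub_cancel_left] at this
    simp only [zero_smul, add_zero, map_add]
    linarith
  have h3 := (dirDeriv_of_isLocalMax_line hs (h2.add h1) hx hmax).2
  rw [dirDeriv_dirDeriv_add hs h2 h1 hx, dirDeriv_dirDeriv_const_mul hs hsm hx,
    dirDeriv_dirDeriv_clm] at h3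
  linarith

variable {n : ℕ} {s : Set (EuclideanSpace ℝ (Fin n))} {g : EuclideanSpace ℝ (Fin n) → ℝ}
  {x : EuclideanSpace ℝ (Fin n)}

theorem hessian_isSymm (hs : IsOpen s) (hg : ContDiffOn ℝ ∞ g s) (hx : x ∈ s) :
    (hessian g x).IsSymm :=
  Matrix.IsSymm.ext fun i j => by
    simp only [hessian, Matrix.of_apply]
    rw [← dirDeriv_dirDeriv_eq hg hs hx, ← dirDeriv_dirDeriv_eq hg hs hx, dirDeriv_comm hg hs hx]

theorem dotProduct_hessian_mulVec (hs : IsOpen s) (hg : ContDiffOn ℝ ∞ g s) (hx : x ∈ s)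
    (v : Fin n → ℝ) :
    v ⬝ᵥ (hessian g x).mulVec v
      = dirDeriv (WithLp.toLp 2 v) (dirDeriv (WithLp.toLp 2 v) g) x := by
  rw [dirDeriv_dirDeriv_eq hg hs hx, bilinear_apply_eq_sum (EuclideanSpace.basisFun (Fin n) ℝ)]
  simp only [dotProduct, Matrix.mulVec, hessian, Matrix.of_apply, Finset.mul_sum,
    EuclideanSpace.basisFun_apply, EuclideanSpace.inner_single_left, map_one, one_mul]
  refine Finset.sum_congr rfl fun i _ => Finset.sum_congr rfl fun j _ => ?_
  ring

theorem ConvexOn.hessian_posSemidef (hc : ConvexOn ℝ s g) (hs : IsOpen s)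
    (hg : ContDiffOn ℝ ∞ g s) (hx : x ∈ s) : (hessian g x).PosSemidef := by
  refine Matrix.PosSemidef.of_dotProduct_mulVec_nonneg (hessian_isSymm hs hg hx).isHermitian_real
    fun v => ?_
  rw [star_trivial, dotProduct_hessian_mulVec hs hg hx]
  exact hc.dirDeriv_dirDeriv_nonneg hs hg hx _

end Convexity

/-! ### Time slices -/

section Slices

open Filter Topology

variable {n : ℕ} {f : EuclideanSpace ℝ (Fin n) × ℝ → ℝ} {r T : ℝ}

theorem dirDeriv_slice {x v : EuclideanSpace ℝ (Fin n)} {t : ℝ} (hf : DifferentiableAt ℝ f (x, t)) :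
    dirDeriv v (fun y => f (y, t)) x = dirDeriv (v, 0) f (x, t) := by
  have h : HasFDerivAt (fun y : EuclideanSpace ℝ (Fin n) => (y, t))
      (ContinuousLinearMap.inl ℝ (EuclideanSpace ℝ (Fin n)) ℝ) x := hasFDerivAt_prodMk_left x t
  have h1 := (hf.hasFDerivAt.comp x h).fderiv
  unfold dirDeriv
  rw [show (fun y => f (y, t)) = f ∘ fun y => (y, t) from rfl, h1]
  simp

theorem dirDeriv_dirDeriv_slice (hf : ContDiffOn ℝ ∞ f (ball 0 r ×ˢ Ioo 0 T))
    {x : EuclideanSpace ℝ (Fin n)} {t : ℝ} (hx : x ∈ ball 0 r) (ht : t ∈ Ioo 0 T)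
    (v w : EuclideanSpace ℝ (Fin n)) :
    dirDeriv v (dirDeriv w fun y => f (y, t)) x = spaceHess f (x, t) v w := by
  have hU : IsOpen (ball (0 : EuclideanSpace ℝ (Fin n)) r ×ˢ Ioo 0 T) := isOpen_ball.prod isOpen_Ioo
  have hp : (x, t) ∈ ball (0 : EuclideanSpace ℝ (Fin n)) r ×ˢ Ioo 0 T := ⟨hx, ht⟩
  rw [spaceHess_apply hU hf hp]
  have h1 := dirDeriv_slice (v := v) ((hf.dirDeriv hU (w, 0)).differentiableAt_of_isOpen hU hp)
  rw [← h1]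
  refine dirDeriv_congr isOpen_ball (fun y hy => ?_) hx v
  have hq : (y, t) ∈ ball (0 : EuclideanSpace ℝ (Fin n)) r ×ˢ Ioo 0 T := ⟨hy, ht⟩
  exact dirDeriv_slice (hf.differentiableAt_of_isOpen hU hq)

/-- Spatial derivatives of a function smooth up to the final time are smooth up to the final
time. -/
theorem exists_contDiffOn_dirDeriv_slice
    (hf : ContDiffOn ℝ ∞ f (ball (0 : EuclideanSpace ℝ (Fin n)) r ×ˢ Ioc 0 T))
    (v : EuclideanSpace ℝ (Fin n)) :
    ∃ g : EuclideanSpace ℝ (Fin n) × ℝ → ℝ, ContDiffOn ℝ ∞ g (ball 0 r ×ˢ Ioc 0 T) ∧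
      ∀ x ∈ ball (0 : EuclideanSpace ℝ (Fin n)) r, ∀ t ∈ Ioc 0 T,
        dirDeriv v (fun y => f (y, t)) x = g (x, t) := by
  set S := ball (0 : EuclideanSpace ℝ (Fin n)) r ×ˢ Ioc 0 T with hS
  have hud : UniqueDiffOn ℝ S := isOpen_ball.uniqueDiffOn.prod (uniqueDiffOn_Ioc 0 T)
  refine ⟨fun q => fderivWithin ℝ f S q (v, 0),
    (hf.fderivWithin hud (by simp)).clm_apply contDiffOn_const, fun x hx t ht => ?_⟩
  have h1 : HasFDerivWithinAt f (fderivWithin ℝ f S (x, t)) S (x, t) :=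
    (hf.differentiableOn (by simp) (x, t) ⟨hx, ht⟩).hasFDerivWithinAt
  have h2 : HasFDerivWithinAt (fun y : EuclideanSpace ℝ (Fin n) => (y, t))
      (ContinuousLinearMap.inl ℝ (EuclideanSpace ℝ (Fin n)) ℝ) (ball 0 r) x :=
    (hasFDerivAt_prodMk_left x t).hasFDerivWithinAt
  have hm : MapsTo (fun y : EuclideanSpace ℝ (Fin n) => (y, t)) (ball 0 r) S :=
    fun y hy => ⟨hy, ht⟩
  have h3 := (h1.comp x h2 hm).hasFDerivAt (isOpen_ball.mem_nhds hx)
  unfold dirDeriv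
  rw [show (fun y => f (y, t)) = f ∘ fun y => (y, t) from rfl, h3.fderiv]
  simp

theorem tendsto_dirDeriv_dirDeriv_slice
    (hf : ContDiffOn ℝ ∞ f (ball (0 : EuclideanSpace ℝ (Fin n)) r ×ˢ Ioc 0 T)) (hT : 0 < T)
    {x : EuclideanSpace ℝ (Fin n)} (hx : x ∈ ball 0 r) (v : EuclideanSpace ℝ (Fin n)) :
    Tendsto (fun t => dirDeriv v (dirDeriv v fun y => f (y, t)) x) (𝓝[<] T)
      (𝓝 (dirDeriv v (dirDeriv v fun y => f (y, T)) x)) := by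
  obtain ⟨g, hg, hfg⟩ := exists_contDiffOn_dirDeriv_slice hf v
  obtain ⟨k, hk, hgk⟩ := exists_contDiffOn_dirDeriv_slice hg v
  have hval : ∀ t ∈ Ioc 0 T, dirDeriv v (dirDeriv v fun y => f (y, t)) x = k (x, t) := by
    intro t ht
    rw [← hgk x hx t ht]
    exact dirDeriv_congr isOpen_ball (fun y hy => hfg y hy t ht) hx v
  have hTm : T ∈ Ioc 0 T := ⟨hT, le_rfl⟩
  rw [hval T hTm]
  have hc : ContinuousOn (fun t => k (x, t)) (Ioc 0 T) :=
    hk.continuousOn.comp (by fun_prop) fun t ht => ⟨hx, ht⟩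
  have hle : 𝓝[<] T ≤ 𝓝[Ioc 0 T] T := by
    rw [← nhdsWithin_Ioo_eq_nhdsLT hT]
    exact nhdsWithin_mono _ Ioo_subset_Ioc_self
  refine ((hc T hTm).mono_left hle).congr' ?_
  filter_upwards [Ioo_mem_nhdsLT hT] with t ht
  exact (hval t ⟨ht.1, ht.2.le⟩).symm

end Slices

/-! ### Estimates for convex solutions -/

section Solutions

open Filter Topology

variable {n : ℕ} {Θ₀ r T : ℝ} {u : EuclideanSpace ℝ (Fin n) → ℝ → ℝ}

theorem IsConvexSolution.contDiffOn_slice (h : IsConvexSolution Θ₀ r T u) {t : ℝ}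
    (ht : t ∈ Ioc 0 T) : ContDiffOn ℝ ∞ (fun y => u y t) (ball 0 r) :=
  h.smooth.comp (f := fun y : EuclideanSpace ℝ (Fin n) => (y, t))
    (contDiff_id.prodMk contDiff_const).contDiffOn fun _ hy => ⟨hy, ht⟩

theorem IsConvexSolution.contDiffOn_interior (h : IsConvexSolution Θ₀ r T u) :
    ContDiffOn ℝ ∞ (fun p : EuclideanSpace ℝ (Fin n) × ℝ => u p.1 p.2)
      (ball 0 r ×ˢ Ioo 0 T) :=
  h.smooth.mono (prod_mono_right Ioo_subset_Ioc_self)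

theorem IsConvexSolution.hasDerivAt (h : IsConvexSolution Θ₀ r T u)
    {x : EuclideanSpace ℝ (Fin n)} (hx : x ∈ ball 0 r) {t : ℝ} (ht : t ∈ Ioo 0 T) :
    HasDerivAt (fun s => u x s) (lagrangianAngle (hessian (fun y => u y t) x) - Θ₀) t :=
  (h.equation x hx t ⟨ht.1, ht.2.le⟩).hasDerivAt (Icc_mem_nhds ht.1 ht.2)

theorem IsConvexSolution.hessian_posSemidef (h : IsConvexSolution Θ₀ r T u)
    {x : EuclideanSpace ℝ (Fin n)} (hx : x ∈ ball 0 r) {t : ℝ} (ht : t ∈ Ioc 0 T) :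
    (hessian (fun y => u y t) x).PosSemidef :=
  (h.convex t ⟨ht.1.le, ht.2⟩).hessian_posSemidef isOpen_ball (h.contDiffOn_slice ht) hx

/-- Since `0 ≤ ∑ arctan λᵢ ≤ nπ/2`, the function `u + Θ₀ t` increases in time at speed at
most `nπ/2`. -/
theorem IsConvexSolution.time_bounds (h : IsConvexSolution Θ₀ r T u)
    {x : EuclideanSpace ℝ (Fin n)} (hx : x ∈ ball 0 r) {t : ℝ} (ht : t ∈ Icc 0 T) :
    u x 0 ≤ u x t + Θ₀ * t ∧ u x t + Θ₀ * t ≤ u x 0 + n * (Real.pi / 2) * t := by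
  have h0 : (0 : ℝ) ∈ Icc 0 T := ⟨le_rfl, ht.1.trans ht.2⟩
  have hc : ContinuousOn (fun s => u x s) (Icc 0 T) :=
    h.continuousOn.comp (f := fun s : ℝ => (x, s)) (by fun_prop) fun s hs => ⟨hx, hs⟩
  have hder : ∀ c : ℝ, ∀ s ∈ interior (Icc 0 T), HasDerivAt (fun s => u x s + c * s)
      (lagrangianAngle (hessian (fun y => u y s) x) - Θ₀ + c) s := by
    intro c s hs
    rw [interior_Icc] at hs
    have := (hasDerivAt_id s).const_mul c
    rw [mul_one] at this
    exact (h.hasDerivAt hx hs).add this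
  have hcont : ∀ c : ℝ, ContinuousOn (fun s => u x s + c * s) (Icc 0 T) := fun c =>
    hc.add (by fun_prop)
  have hpsd : ∀ s ∈ interior (Icc 0 T), (hessian (fun y => u y s) x).PosSemidef := by
    intro s hs
    rw [interior_Icc] at hs
    exact h.hessian_posSemidef hx ⟨hs.1, hs.2.le⟩
  constructor
  · have hmono : MonotoneOn (fun s => u x s + Θ₀ * s) (Icc 0 T) :=
      monotoneOn_of_deriv_nonneg (convex_Icc 0 T) (hcont Θ₀)
        (fun s hs => (hder Θ₀ s hs).differentiableAt.differentiableWithinAt) fun s hs => by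
          rw [(hder Θ₀ s hs).deriv]
          have := lagrangianAngle_nonneg (hpsd s hs)
          linarith
    simpa using hmono h0 ht ht.1
  · have hanti : AntitoneOn (fun s => u x s + (Θ₀ - n * (Real.pi / 2)) * s) (Icc 0 T) :=
      antitoneOn_of_deriv_nonpos (convex_Icc 0 T) (hcont _)
        (fun s hs => (hder _ s hs).differentiableAt.differentiableWithinAt) fun s hs => by
          rw [(hder _ s hs).deriv]
          have := lagrangianAngle_le (hpsd s hs).isHermitian
          linarith
    have := hanti h0 ht ht.1
    simp only [mul_zero, add_zero] at this
    linarith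

/-- The time derivative of the solution as a derivative of the function on space-time. -/
theorem IsConvexSolution.dirDeriv_time (h : IsConvexSolution Θ₀ r T u)
    {x : EuclideanSpace ℝ (Fin n)} (hx : x ∈ ball 0 r) {t : ℝ} (ht : t ∈ Ioo 0 T) :
    dirDeriv (0, 1) (fun p : EuclideanSpace ℝ (Fin n) × ℝ => u p.1 p.2) (x, t)
      = lagrangianAngle (hessian (fun y => u y t) x) - Θ₀ := by
  have hU : IsOpen (ball (0 : EuclideanSpace ℝ (Fin n)) r ×ˢ Ioo 0 T) := isOpen_ball.prod isOpen_Ioo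
  have h1 := h.contDiffOn_interior.differentiableAt_of_isOpen hU
    (show (x, t) ∈ ball 0 r ×ˢ Ioo 0 T from ⟨hx, ht⟩)
  have h2 : HasDerivAt (fun s : ℝ => (x, s)) ((0, 1) : EuclideanSpace ℝ (Fin n) × ℝ) t :=
    (hasDerivAt_const t x).prodMk (hasDerivAt_id t)
  exact (h1.hasFDerivAt.comp_hasDerivAt t h2).unique (h.hasDerivAt hx ht)

/-- The equation in the form used by the maximum principle: in every orthonormal basis,
`u_t + Θ₀` is an argument of `det (1 + i D²u)`. -/
theorem IsConvexSolution.det_oneAddI_mul_exp_im (h : IsConvexSolution Θ₀ r T u)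
    (b : OrthonormalBasis (Fin n) ℝ (EuclideanSpace ℝ (Fin n)))
    {q : EuclideanSpace ℝ (Fin n) × ℝ} (hq : q ∈ ball 0 r ×ˢ Ioo 0 T) :
    ((oneAddI (hessMatrix (fun i => (b i, (0 : ℝ)))
      (fun p : EuclideanSpace ℝ (Fin n) × ℝ => u p.1 p.2) q)).det *
      Complex.exp (-((dirDeriv (0, 1) (fun p : EuclideanSpace ℝ (Fin n) × ℝ => u p.1 p.2) q
        + Θ₀ : ℝ) * Complex.I))).im = 0 := by
  obtain ⟨x, t⟩ := q
  obtain ⟨hx, ht⟩ := hq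
  have hU : IsOpen (ball (0 : EuclideanSpace ℝ (Fin n)) r ×ˢ Ioo 0 T) := isOpen_ball.prod isOpen_Ioo
  have hf := h.contDiffOn_interior
  have hs := h.contDiffOn_slice (t := t) ⟨ht.1, ht.2.le⟩
  set H := hessian (fun y => u y t) x with hH
  set B : Matrix (Fin n) (Fin n) ℝ := Matrix.of fun k i => b i k with hB
  have hBB : B.transpose * B = 1 := by
    ext i j
    have h1 : inner ℝ (b j) (b i) = (1 : Matrix (Fin n) (Fin n) ℝ) i j := by
      rw [orthonormal_iff_ite.1 b.orthonormal, Matrix.one_apply]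
      simp only [eq_comm]
    rw [← h1, Matrix.mul_apply, PiLp.inner_apply]
    simp [hB]
  have hconj : hessMatrix (fun i => (b i, (0 : ℝ)))
      (fun p : EuclideanSpace ℝ (Fin n) × ℝ => u p.1 p.2) (x, t) = B.transpose * H * B := by
    ext i j
    have h1 : hessMatrix (fun i => (b i, (0 : ℝ)))
        (fun p : EuclideanSpace ℝ (Fin n) × ℝ => u p.1 p.2) (x, t) i j
        = fderiv ℝ (fderiv ℝ fun y => u y t) x (b i) (b j) := by
      rw [← dirDeriv_dirDeriv_eq hs isOpen_ball hx, dirDeriv_dirDeriv_slice hf hx ht,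
        spaceHess_apply hU hf ⟨hx, ht⟩]
      rfl
    rw [h1, bilinear_apply_eq_sum (EuclideanSpace.basisFun (Fin n) ℝ), Matrix.mul_apply]
    simp only [Matrix.mul_apply, Finset.sum_mul, hH, hB, hessian, Matrix.of_apply,
      Matrix.transpose_apply, EuclideanSpace.basisFun_apply, EuclideanSpace.inner_single_left,
      map_one, one_mul]
    rw [Finset.sum_comm]
    refine Finset.sum_congr rfl fun k _ => Finset.sum_congr rfl fun l _ => ?_
    ring
  rw [hconj, det_oneAddI_conj hBB, h.dirDeriv_time hx ht, sub_add_cancel]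
  exact _root_.det_oneAddI_mul_exp_im (hessian_isSymm isOpen_ball hs hx)

/-- The gradient bound: by convexity `|Du|` is at most the oscillation `2 + π/2` of `u(·,t)`
divided by the distance `5√n`. -/
theorem IsConvexSolution.norm_spaceDeriv_sq_le (hn : 1 ≤ n) (hr : 6 * Real.sqrt n < r)
    (h : IsConvexSolution Θ₀ r (1 / (n : ℝ)) u)
    (h0 : ∀ x ∈ ball (0 : EuclideanSpace ℝ (Fin n)) r, -1 ≤ u x 0 ∧ u x 0 ≤ 1)
    {q : EuclideanSpace ℝ (Fin n) × ℝ} (hq : q ∈ ball 0 r ×ˢ Ioo 0 (1 / (n : ℝ)))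
    (hx : ‖q.1‖ ≤ Real.sqrt n) :
    ‖spaceDeriv (fun p : EuclideanSpace ℝ (Fin n) × ℝ => u p.1 p.2) q‖ ^ 2 ≤ 13 / (25 * n) := by
  obtain ⟨x, t⟩ := q
  obtain ⟨hxr, ht⟩ := hq
  simp only at hx hxr ht
  have hn0 : (0 : ℝ) < n := by exact_mod_cast hn
  have hsq : 0 < Real.sqrt n := Real.sqrt_pos.2 hn0
  have htI : t ∈ Icc 0 (1 / (n : ℝ)) := ⟨ht.1.le, ht.2.le⟩
  have hpi := Real.pi_lt_d2
  -- `2 + π/2 ≤ 3.575` since `π < 3.15`; what matters is `3.575² ≤ 13`.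
  have hosc : ∀ y ∈ ball (0 : EuclideanSpace ℝ (Fin n)) r, u y t - u x t ≤ 3.575 := by
    intro y hy
    have h1 := (h.time_bounds hy htI).2
    have h2 := (h.time_bounds hxr htI).1
    have h3 := (h0 y hy).2
    have h4 := (h0 x hxr).1
    have h5 : (n : ℝ) * (Real.pi / 2) * t ≤ Real.pi / 2 := by
      have h6 : (n : ℝ) * t ≤ 1 := by
        have := ht.2.le
        rw [le_div_iff₀ hn0] at this
        linarith
      have := mul_le_mul_of_nonneg_left h6 (by positivity : 0 ≤ Real.pi / 2)
      linarith
    norm_num at hpi ⊢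
    linarith
  have hU : IsOpen (ball (0 : EuclideanSpace ℝ (Fin n)) r ×ˢ Ioo 0 (1 / (n : ℝ))) :=
    isOpen_ball.prod isOpen_Ioo
  have hd := h.contDiffOn_interior.differentiableAt_of_isOpen hU
    (show (x, t) ∈ ball 0 r ×ˢ Ioo 0 (1 / (n : ℝ)) from ⟨hxr, ht⟩)
  set D := spaceDeriv (fun p : EuclideanSpace ℝ (Fin n) × ℝ => u p.1 p.2) (x, t) with hD
  have hDv : ∀ v, D v = fderiv ℝ (fun y => u y t) x v := fun v =>
    (dirDeriv_slice (v := v) hd).symm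
  have hslice : DifferentiableAt ℝ (fun y => u y t) x :=
    (h.contDiffOn_slice ⟨ht.1, ht.2.le⟩).differentiableAt_of_isOpen isOpen_ball hxr
  have hle : ∀ v, D v ≤ 3.575 / (5 * Real.sqrt n) * ‖v‖ := by
    intro v
    rcases eq_or_ne v 0 with rfl | hv
    · simp
    have hv0 : 0 < ‖v‖ := norm_pos_iff.2 hv
    set a := 5 * Real.sqrt n / ‖v‖ with ha
    have ha0 : 0 < a := by positivity
    have hy : x + a • v ∈ ball (0 : EuclideanSpace ℝ (Fin n)) r := by
      rw [mem_ball_zero_iff]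
      calc ‖x + a • v‖ ≤ ‖x‖ + ‖a • v‖ := norm_add_le _ _
        _ = ‖x‖ + 5 * Real.sqrt n := by
            rw [norm_smul, Real.norm_of_nonneg ha0.le, ha, div_mul_cancel₀ _ hv0.ne']
        _ < r := by linarith
    have h1 := (h.convex t htI).add_fderiv_le hslice hxr hy
    rw [add_sub_cancel_left, map_smul, smul_eq_mul, ← hDv] at h1
    have h2 := hosc _ hy
    have h3 : a * D v ≤ 3.575 := by linarith
    rw [ha] at h3
    rw [div_mul_eq_mul_div, div_le_iff₀ hv0] at h3
    rw [div_mul_eq_mul_div, le_div_iff₀ (by positivity)]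
    linarith
  have hnorm : ‖D‖ ≤ 3.575 / (5 * Real.sqrt n) := by
    refine D.opNorm_le_bound (by positivity) fun v => ?_
    rw [Real.norm_eq_abs, abs_le]
    have h1 := hle v
    have h2 := hle (-v)
    rw [map_neg, norm_neg] at h2
    constructor <;> linarith
  calc ‖D‖ ^ 2 ≤ (3.575 / (5 * Real.sqrt n)) ^ 2 := pow_le_pow_left₀ (norm_nonneg _) hnorm 2
    _ = 3.575 ^ 2 / (25 * n) := by
        rw [div_pow, mul_pow, Real.sq_sqrt hn0.le]; norm_num
    _ ≤ 13 / (25 * n) := by gcongr; norm_num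

end Solutions

/-! ### The Hessian estimate -/

theorem mainTheorem2 (n : ℕ) (hn : 1 ≤ n) :
    ∃ C : ℝ, ∀ (Θ₀ R : ℝ) (u : EuclideanSpace ℝ (Fin n) → ℝ → ℝ),
      R = 3 * Real.sqrt n →
      IsConvexSolution Θ₀ (2 * R + 1) (1 / (n : ℝ)) u →
      (∀ x ∈ ball (0 : EuclideanSpace ℝ (Fin n)) (2 * R + 1), -1 ≤ u x 0 ∧ u x 0 ≤ 1) →
      (C • (1 : Matrix (Fin n) (Fin n) ℝ) - hessian (fun x => u x (1 / (n : ℝ))) 0).PosSemidef := by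
  have hn0 : (0 : ℝ) < n := by exact_mod_cast hn
  have hsqrt : 0 < Real.sqrt n := Real.sqrt_pos.2 hn0
  obtain ⟨K, hK⟩ : ∃ K : ℝ, K = (n : ℝ) ^ 2 / 2 + n := ⟨_, rfl⟩
  have hK0 : 0 ≤ K := by rw [hK]; positivity
  -- Near `(0, 1/n)` the cutoff is at least `n/10`, so `φ² u_ee ≤ n² (K + 3)` yields `100 (K + 3)`.
  refine ⟨100 * (K + 3), fun Θ₀ R u hR h h0 => ?_⟩
  have hr : 6 * Real.sqrt n < 2 * R + 1 := by rw [hR]; linarith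
  have hr' : Real.sqrt n < 2 * R + 1 := by linarith
  have hr0 : 0 < 2 * R + 1 := hsqrt.trans hr'
  have hT : 0 < 1 / (n : ℝ) := by positivity
  have hTm : 1 / (n : ℝ) ∈ Ioc 0 (1 / (n : ℝ)) := ⟨hT, le_rfl⟩
  have hc0 : (0 : EuclideanSpace ℝ (Fin n)) ∈ ball 0 (2 * R + 1) := mem_ball_self hr0
  have hf := h.contDiffOn_interior
  have hU : IsOpen (ball (0 : EuclideanSpace ℝ (Fin n)) (2 * R + 1) ×ˢ Ioo 0 (1 / (n : ℝ))) :=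
    isOpen_ball.prod isOpen_Ioo
  have hs := h.contDiffOn_slice hTm
  have hunit : ∀ t ∈ Ioo (19 / (20 * (n : ℝ))) (1 / n), ∀ v, ‖v‖ = 1 →
      spaceHess (fun p : EuclideanSpace ℝ (Fin n) × ℝ => u p.1 p.2) (0, t) v v
        ≤ 100 * (K + 3) := by
    intro t ht v hv
    have ht0 : t ∈ Ioo 0 (1 / (n : ℝ)) := ⟨lt_trans (by positivity) ht.1, ht.2⟩
    have hφ : (n : ℝ) / 10 ≤
        cutoff K (fun p : EuclideanSpace ℝ (Fin n) × ℝ => u p.1 p.2) (0, t) := by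
      have h1 := ht.1
      rw [div_lt_iff₀ (by positivity)] at h1
      have h2 : 0 ≤ K * ‖spaceDeriv (fun p : EuclideanSpace ℝ (Fin n) × ℝ => u p.1 p.2)
        (0, t)‖ ^ 2 := by positivity
      simp only [cutoff, norm_zero]
      nlinarith
    have hmain := cutoff_sq_mul_spaceHess_le hn hr' hK rfl hf
      (fun b q hq => h.det_oneAddI_mul_exp_im b hq)
      (fun q hq w => by
        rw [← dirDeriv_dirDeriv_slice hf hq.1 hq.2]
        exact (h.convex q.2 ⟨hq.2.1.le, hq.2.2.le⟩).dirDeriv_dirDeriv_nonneg isOpen_ball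
          (h.contDiffOn_slice ⟨hq.2.1, hq.2.2.le⟩) hq.1 w)
      (fun q hq hx => h.norm_spaceDeriv_sq_le hn hr h0 hq hx)
      (q₁ := (0, t)) ⟨hc0, ht0⟩ (by simp) (lt_of_lt_of_le (by positivity) hφ) hv
    by_contra! hlt
    have h1 : ((n : ℝ) / 10) ^ 2
        ≤ cutoff K (fun p : EuclideanSpace ℝ (Fin n) × ℝ => u p.1 p.2) (0, t) ^ 2 :=
      pow_le_pow_left₀ (by positivity) hφ 2
    have h2 := mul_le_mul_of_nonneg_right h1 ((by positivity : 0 ≤ 100 * (K + 3)).trans hlt.le)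
    have h3 := mul_lt_mul_of_pos_left hlt (by positivity : 0 < ((n : ℝ) / 10) ^ 2)
    linarith
  have hall : ∀ v, dirDeriv v (dirDeriv v fun y => u y (1 / (n : ℝ))) 0
      ≤ 100 * (K + 3) * ‖v‖ ^ 2 := by
    intro v
    refine le_of_tendsto (tendsto_dirDeriv_dirDeriv_slice
      (f := fun p : EuclideanSpace ℝ (Fin n) × ℝ => u p.1 p.2) h.smooth hT hc0 v) ?_
    have hlt : 19 / (20 * (n : ℝ)) < 1 / n := by
      rw [div_lt_div_iff₀ (by positivity) hn0]; linarith
    filter_upwards [Ioo_mem_nhdsLT hlt] with t ht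
    have ht0 : t ∈ Ioo 0 (1 / (n : ℝ)) := ⟨lt_trans (by positivity) ht.1, ht.2⟩
    rw [dirDeriv_dirDeriv_slice hf hc0 ht0]
    rcases eq_or_ne v 0 with rfl | hv
    · simp
    have hv0 : 0 < ‖v‖ := norm_pos_iff.2 hv
    have h1 := hunit t ht (‖v‖⁻¹ • v) (norm_smul_inv_norm hv)
    simp only [map_smul, _root_.smul_apply, smul_eq_mul] at h1
    rw [← mul_assoc, ← mul_inv, inv_mul_le_iff₀ (by positivity)] at h1
    linarith
  refine Matrix.PosSemidef.of_dotProduct_mulVec_nonneg ?_ fun v => ?_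
  · exact ((Matrix.isSymm_one.smul _).sub (hessian_isSymm isOpen_ball hs hc0)).isHermitian_real
  · rw [star_trivial, Matrix.sub_mulVec, dotProduct_sub, Matrix.smul_mulVec, Matrix.one_mulVec,
      dotProduct_hessian_mulVec isOpen_ball hs hc0, dotProduct_smul, smul_eq_mul, sub_nonneg]
    have h1 : v ⬝ᵥ v = ‖WithLp.toLp 2 v‖ ^ 2 := by
      rw [EuclideanSpace.norm_sq_eq]
      simp [dotProduct, pow_two]
    rw [h1]
    exact hall _
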